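/- Conventions. For $1\le p\le\infty$ and $t\in\mathbb R$, let $|z|^tL^p_{loc}(\mathbb C)$ be the set of functions $f$ on $\mathbb C$ such that $|z|^{-t}f\in L^p_{loc}(\mathbb C)$, and let $$k(p,t):=\max\{\mu\in\mathbb Z:\ |z|^tL^p_{loc}(\mathbb C)\subset|z|^\mu L^1_{loc}(\mathbb C)\}.$$ (This maximum exists.) For $s\in\mathbb R^n$ put $k(p,s):=(k(p,s_1),\dots,k(p,s_n))$. For an open set $P\subset\mathbb C^n$, let $|z|^sL^p_{0,q}(P)$ be the set of $(0,q)$-forms $\omega$ on $P$ such that the coefficients of $|z|^{-s}\omega$ are in $L^p(P)$, where $|z|^{-s}=|z_1|^{-s_1}\cdots|z_n|^{-s_n}$. For $m\in\mathbb Z^n$ and a measurable form $f$ on $P$ such that $z^{-m}f$ and the distributional derivative $\bar\partial(z^{-m}f)$ have coefficients in $L^1_{loc}(P)$, put $\bar\partial_mf:=z^m\,\bar\partial(z^{-m}f)$, where $z^m=z_1^{m_1}\cdots z_n^{m_n}$. If $P=D_1\times\cdots\times D_n$, $\mu\in\mathbb Z$ and $\omega=\sum_{e\notin J}a_{eJ}\,d\bar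 z_e\wedge d\bar z_J+\sum_{e\notin L}a_L\,d\bar z_L$, put $$\mathbf I^{P_e}_{\mu}\omega(z):=\frac{z_e^{\mu}}{2\pi i}\sum_{e\notin J}\left(\int_{\zeta_e\in D_e}a_{eJ}(\dots,z_{e-1},\zeta_e,z_{e+1},\dots)\,\frac{d\zeta_e\wedge d\bar\zeta_e}{\zeta_e^{\mu}(\zeta_e-z_e)}\right)d\bar z_J .$$ **Lemma 4.1.** Let $P=D_1\times\cdots\times D_n\subset\mathbb C^n$ be a product of bounded domains $D_j\subset\mathbb C$, let $1\le q\le e\le n$, $1\le p\le\infty$, $s\in\mathbb R^n$, and let $m\in\mathbb Z^n$ satisfy $m_j\le k(p,s_j)$ for all $j$. Let $\omega\in|z|^sL^p_{0,q}(P)$ have compact support in $D_e$, i.e. there is a compact set $K\subset D_e$ such that $\omega=0$ almost everywhere on $\{z\in P: z_e\notin K\}$. Assume that $\bar\partial_m\omega$ exists on $P$ and that $\bar\partial_m\omega\in|z|^sL^p_{0,q+1}(P)$. Then the integrals defining $\mathbf I^{P_e}_{m_e}\omega(z)$ and $\mathbf I^{P_e}_{m_e}\bar\partial_m\omega(z)$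 converge for almost every $z\in P$, the form $\bar\partial_m\mathbf I^{P_e}_{m_e}\omega$ exists on $P$ (that is, $z^{-m}\mathbf I^{P_e}_{m_e}\omega$ and its distributional $\bar\partial$ have coefficients in $L^1_{loc}(P)$), and $$\omega=\bar\partial_m\mathbf I^{P_e}_{m_e}\omega+\mathbf I^{P_e}_{m_e}\bar\partial_m\omega$$ almost everywhere on $P$. -/

import Mathlib

open MeasureTheory Set
open scoped ENNReal

noncomputable section

/-- `f` belongs to `|z|^s L^p_loc(ℂ)`, that is, `|z|^{-s} f` is in `L^p(K)` for all compact `K`. -/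
def MemWeightedLpLoc (p : ℝ≥0∞) (s : ℝ) (f : ℂ → ℂ) : Prop :=
  ∀ K : Set ℂ, IsCompact K →
    MemLp (fun z => ((‖z‖ ^ (-s) : ℝ) : ℂ) * f z) p (volume.restrict K)

/-- The integers `m` with `|z|^s L^p_loc(ℂ) ⊆ |z|^m L^1_loc(ℂ)`. -/
def dbarWeightSet (p : ℝ≥0∞) (s : ℝ) : Set ℤ :=
  {m | ∀ f : ℂ → ℂ, MemWeightedLpLoc p s f → MemWeightedLpLoc 1 (m : ℝ) f}

/-- The `∂̄`-weight `k(p, s) = max {m ∈ ℤ : |z|^s L^p_loc(ℂ) ⊆ |z|^m L^1_loc(ℂ)}`. The maximum is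
attained for all `p ≥ 1`, see `dbarWeight_isGreatest`. -/
def dbarWeight (p : ℝ≥0∞) (s : ℝ) : ℤ := sSup (dbarWeightSet p s)

theorem dbarWeightSet_nonempty (p : ℝ≥0∞) (hp : 1 ≤ p) (s : ℝ) : (dbarWeightSet p s).Nonempty := by
  refine ⟨⌊s⌋, fun f hf K hK => ?_⟩
  have : IsFiniteMeasure (volume.restrict K : Measure ℂ) := ⟨by
    simpa using hK.measure_lt_top⟩
  have h1 : MemLp (fun z => ((‖z‖ ^ (-s) : ℝ) : ℂ) * f z) 1 (volume.restrict K) :=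
    (hf K hK).mono_exponent hp
  obtain ⟨R, hR⟩ := hK.isBounded.exists_norm_le
  have h0 : ∀ᵐ z : ℂ ∂(volume.restrict K), z ≠ 0 := by
    refine ae_restrict_of_ae ?_
    simp [ae_iff]
  have h2 : MemLp (fun z : ℂ => ((‖z‖ ^ (s - (⌊s⌋ : ℝ)) : ℝ) : ℂ) *
      (((‖z‖ ^ (-s) : ℝ) : ℂ) * f z)) 1 (volume.restrict K) := by
    refine h1.of_le_mul (c := R ^ (s - (⌊s⌋ : ℝ))) ?_ ?_
    · refine AEStronglyMeasurable.mul ?_ h1.1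
      exact (by fun_prop : Measurable fun z : ℂ =>
        ((‖z‖ ^ (s - (⌊s⌋ : ℝ)) : ℝ) : ℂ)).aestronglyMeasurable
    · filter_upwards [ae_restrict_mem hK.measurableSet] with z hz
      rw [norm_mul]
      gcongr
      rw [Complex.norm_real, Real.norm_of_nonneg (by positivity)]
      exact Real.rpow_le_rpow (norm_nonneg _) (hR z hz) (sub_nonneg.2 (Int.floor_le s))
  refine h2.ae_eq ?_
  filter_upwards [h0] with z hz
  rw [← mul_assoc, ← Complex.ofReal_mul, ← Real.rpow_add (norm_pos_iff.2 hz)]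
  congr 3
  ring

theorem dbarWeightSet_bddAbove (p : ℝ≥0∞) (s : ℝ) : BddAbove (dbarWeightSet p s) := by
  refine ⟨⌈s + 2⌉, fun m hm => ?_⟩
  by_contra! hlt
  have hlt' : s + 2 ≤ (m : ℝ) := (Int.le_ceil _).trans (by exact_mod_cast hlt.le)
  have h0 : ∀ᵐ z : ℂ, z ≠ 0 := by simp [ae_iff]
  have hf : MemWeightedLpLoc p s (fun z => ((‖z‖ ^ s : ℝ) : ℂ)) := by
    intro K hK
    have : IsFiniteMeasure (volume.restrict K : Measure ℂ) := ⟨by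
      simpa using hK.measure_lt_top⟩
    refine (memLp_const (1 : ℂ)).ae_eq ?_
    filter_upwards [ae_restrict_of_ae h0] with z hz
    rw [← Complex.ofReal_mul, ← Real.rpow_add (norm_pos_iff.2 hz)]
    simp
  have h1 := (memLp_one_iff_integrable.1 (hm _ hf _ (isCompact_closedBall (0 : ℂ) 1))).norm
  have h2 : IntegrableOn (fun z : ℂ => ‖z‖ ^ (s - m)) (Metric.closedBall 0 1) := by
    refine h1.congr ?_
    filter_upwards [ae_restrict_of_ae h0] with z hz
    rw [← Complex.ofReal_mul, ← Real.rpow_add (norm_pos_iff.2 hz), Complex.norm_real,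
      Real.norm_of_nonneg (by positivity)]
    congr 1
    ring
  rw [← integrable_indicator_iff Metric.isClosed_closedBall.measurableSet] at h2
  have h3 : Integrable (fun z : ℂ => (Set.Iic (1 : ℝ)).indicator (fun r => r ^ (s - m)) ‖z‖) := by
    refine h2.congr (Filter.Eventually.of_forall fun z => ?_)
    simp [Set.indicator, Metric.mem_closedBall]
  rw [integrable_fun_norm_addHaar (volume : Measure ℂ)
    (f := (Set.Iic (1 : ℝ)).indicator (fun r => r ^ (s - m)))] at h3
  have h4 : IntegrableOn (fun r : ℝ => r ^ (s - m + 1)) (Set.Ioo 0 1) := by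
    refine (h3.mono_set Set.Ioo_subset_Ioi_self).congr_fun ?_ measurableSet_Ioo
    intro r hr
    simp only [Complex.finrank_real_complex, smul_eq_mul]
    rw [Set.indicator_of_mem (by exact hr.2.le), Real.rpow_add hr.1, Real.rpow_one]
    simp [mul_comm]
  rw [intervalIntegral.integrableOn_Ioo_rpow_iff one_pos] at h4
  linarith

theorem dbarWeight_isGreatest (p : ℝ≥0∞) (hp : 1 ≤ p) (s : ℝ) :
    IsGreatest (dbarWeightSet p s) (dbarWeight p s) :=
  ⟨Int.csSup_mem (dbarWeightSet_nonempty p hp s) (dbarWeightSet_bddAbove p s),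
    fun _ hm => le_csSup (dbarWeightSet_bddAbove p s) hm⟩

/-- A `(0, *)`-form `ω = ∑_J ω_J dz̄_J` on `ℂⁿ`, given by its coefficient functions. Here
`dz̄_J = dz̄_{j_1} ∧ ⋯ ∧ dz̄_{j_q}` for `J = {j_1 < ⋯ < j_q}`. -/
abbrev DbarForm (n : ℕ) : Type := Finset (Fin n) → (Fin n → ℂ) → ℂ

/-- `ω` is a `(0, q)`-form: only the coefficients with `|J| = q` occur. -/
def IsOfDegree {n : ℕ} (q : ℕ) (ω : DbarForm n) : Prop :=
  ∀ J : Finset (Fin n), J.card ≠ q → ω J = 0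

/-- The sign with `dz̄_j ∧ dz̄_J = wedgeSign j J • dz̄_{J ∪ {j}}`, for `j ∉ J`. -/
def wedgeSign {n : ℕ} (j : Fin n) (J : Finset (Fin n)) : ℂ :=
  (-1) ^ (J.filter (· < j)).card

/-- The form `z^a ω`, where `z^a = z_1^{a_1} ⋯ z_n^{a_n}`. -/
def monomialMul {n : ℕ} (a : Fin n → ℤ) (ω : DbarForm n) : DbarForm n :=
  fun J z => (∏ j, z j ^ a j) * ω J z

/-- `ω ∈ |z|^s L^p_{0,q}(P)`: a `(0, q)`-form such that `|z|^{-s} ω` has coefficients in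
`L^p(P)`. -/
def MemWeightedLp {n : ℕ} (P : Set (Fin n → ℂ)) (p : ℝ≥0∞) (s : Fin n → ℝ) (q : ℕ)
    (ω : DbarForm n) : Prop :=
  IsOfDegree q ω ∧ ∀ J : Finset (Fin n),
    MemLp (fun z => ((∏ j, ‖z j‖ ^ (-s j) : ℝ) : ℂ) * ω J z) p (volume.restrict P)

/-- The coefficients of `ω` are in `L^1_loc(P)`. -/
def LocIntegrableForm {n : ℕ} (P : Set (Fin n → ℂ)) (ω : DbarForm n) : Prop :=
  ∀ J : Finset (Fin n), LocallyIntegrableOn (ω J) P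

/-- `∂φ/∂z̄_j = (∂φ/∂x_j + i ∂φ/∂y_j) / 2`. -/
def dzbar {n : ℕ} (j : Fin n) (φ : (Fin n → ℂ) → ℂ) (z : Fin n → ℂ) : ℂ :=
  (fderiv ℝ φ z (Pi.single j 1) + Complex.I * fderiv ℝ φ z (Pi.single j Complex.I)) / 2

/-- `∂̄ u = v` on `P` in the sense of distributions, coefficient by coefficient:
`v_L = ∑_{j ∈ L} ± ∂u_{L ∖ j}/∂z̄_j`, tested against `C^∞` functions with compact support in `P`. -/
def IsWeakDbar {n : ℕ} (P : Set (Fin n → ℂ)) (u v : DbarForm n) : Prop :=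
  ∀ (L : Finset (Fin n)) (φ : (Fin n → ℂ) → ℂ),
    ContDiff ℝ ((⊤ : ℕ∞) : WithTop ℕ∞) φ → HasCompactSupport φ → tsupport φ ⊆ P →
      ∑ j ∈ L, wedgeSign j (L.erase j) * (-∫ z in P, u (L.erase j) z * dzbar j φ z)
        = ∫ z in P, v L z * φ z

/-- `∂̄_k f` is defined on `P` and `g` represents it: `z^{-k} f` and `∂̄(z^{-k} f)` are in
`L^1_loc(P)`, and `g = z^k ∂̄(z^{-k} f)` almost everywhere. -/
def IsDbarWeighted {n : ℕ} (P : Set (Fin n → ℂ)) (k : Fin n → ℤ) (f g : DbarForm n) : Prop :=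
  LocIntegrableForm P (monomialMul (-k) f) ∧ LocIntegrableForm P (monomialMul (-k) g) ∧
    IsWeakDbar P (monomialMul (-k) f) (monomialMul (-k) g)

/-- For `e ∉ J`, the coefficient of `dz̄_e ∧ dz̄_J` in `ω` at `(…, z_{e-1}, ζ, z_{e+1}, …)`, divided
by `ζ^k (ζ - z_e)`: the integrand of the Cauchy operator. -/
def cauchyIntegrand {n : ℕ} (e : Fin n) (k : ℤ) (ω : DbarForm n) (J : Finset (Fin n))
    (z : Fin n → ℂ) (ζ : ℂ) : ℂ :=
  wedgeSign e J * ω (insert e J) (Function.update z e ζ) / (ζ ^ k * (ζ - z e))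

/-- The Cauchy operator in the `e`-th variable,
`(z_e^k / 2πi) ∑_{e ∉ J} (∫_{ζ ∈ D} a_{eJ}(…, ζ, …) / (ζ^k (ζ - z_e)) dζ ∧ dζ̄) dz̄_J`
for `ω = ∑_{e ∉ J} a_{eJ} dz̄_e ∧ dz̄_J + (terms without dz̄_e)`;
here `dζ ∧ dζ̄ = -2i dV(ζ)`, with `V` the Lebesgue measure. -/
def cauchyOp {n : ℕ} (D : Set ℂ) (e : Fin n) (k : ℤ) (ω : DbarForm n) : DbarForm n :=
  fun J z =>
    if e ∈ J then 0
    else z e ^ k / (2 * Real.pi * Complex.I) *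
      ((-2 * Complex.I) * ∫ ζ in D, cauchyIntegrand e k ω J z ζ)

/-- The integrals that define `cauchyOp D e k ω` converge at almost all points of `P`. -/
def CauchyOpExists {n : ℕ} (P : Set (Fin n → ℂ)) (D : Set ℂ) (e : Fin n) (k : ℤ)
    (ω : DbarForm n) : Prop :=
  ∀ J : Finset (Fin n), e ∉ J →
    ∀ᵐ z ∂(volume.restrict P), IntegrableOn (cauchyIntegrand e k ω J z) D

end

/-! Put u = z^{-m} ω and v = z^{-m} ∂̄_m ω. The proof removes the weights and then dualizes an
unweighted homotopy formula.

Weights. Testing the inclusion that defines k(p,s) on radial functions shows that m ≤ k(p,s) forces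
s - m ≥ 0 for p = 1 and s - m > -2 + 2/p for p > 1. On a bounded product this puts |z|^{s-m} in the
dual exponent space (`memLp_prod_norm_rpow_sub`), so Hölder gives u, v ∈ L¹(P). Conjugation by z^m
turns the weighted operator into the plain Cauchy transform in z_e (`monomialMul_cauchyOp_ae_eq`).

Homotopy formula for L¹ forms (`IsWeakDbar.cauchyForm`). The Cauchy transform C in z_e is
skew-symmetric, so it can be moved onto a test function φ. There C commutes with every ∂/∂z̄_j, and
C(∂φ/∂z̄_e) = -φ by Cauchy-Pompeiu. Coefficients containing dz̄_e need only the latter. The others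
use ∂̄u = v tested on Cφ. This function need not have compact support in the z_e direction, but u
and v vanish for z_e outside K, so Cφ may be cut off away from K. The signs match because the dz̄_j
anticommute. -/

/-! ### Local integrability of powers of |z| -/

theorem integrableOn_norm_rpow_ball {a : ℝ} (ha : -2 < a) (R : ℝ) :
    IntegrableOn (fun z : ℂ => ‖z‖ ^ a) (Metric.ball 0 R) := by
  rw [integrableOn_fun_norm_addHaar (volume : Measure ℂ) (f := fun r => r ^ a)]
  rcases le_or_gt R 0 with hR | hR
  · simp [Ioo_eq_empty_of_le hR]
  have h : IntegrableOn (fun r : ℝ => r ^ (a + 1)) (Ioo 0 R) := by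
    rw [intervalIntegral.integrableOn_Ioo_rpow_iff hR]
    linarith
  refine h.congr_fun (fun r hr => ?_) measurableSet_Ioo
  simp only [Complex.finrank_real_complex, smul_eq_mul]
  rw [Real.rpow_add hr.1, Real.rpow_one]
  simp [mul_comm]

theorem integrableOn_inv_ball (R : ℝ) : IntegrableOn (fun t : ℂ => t⁻¹) (Metric.ball 0 R) := by
  refine (integrableOn_norm_rpow_ball (a := -1) (by norm_num) R).mono'
    measurable_inv.aestronglyMeasurable (Filter.Eventually.of_forall fun z => ?_)
  rw [norm_inv, Real.rpow_neg_one]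

theorem locallyIntegrable_complex_inv : LocallyIntegrable (fun t : ℂ => t⁻¹) := fun x =>
  ⟨Metric.ball 0 (‖x‖ + 1), Metric.isOpen_ball.mem_nhds (by simp), integrableOn_inv_ball _⟩

/-! ### The Cauchy-Pompeiu formula in the plane, by polar coordinates -/

section Pompeiu

variable {g : ℂ → ℂ}

theorem hasDerivAt_radial (hg : ContDiff ℝ 1 g) (c : ℂ) (r : ℝ) :
    HasDerivAt (fun r : ℝ => g (r * c)) (fderiv ℝ g (r * c) c) r := by
  have h1 : HasDerivAt (fun r : ℝ => (r : ℂ) * c) c r := by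
    simpa using (Complex.ofRealCLM.hasDerivAt (x := r)).mul_const c
  exact ((hg.differentiable one_ne_zero).differentiableAt.hasFDerivAt).comp_hasDerivAt r h1

theorem hasDerivAt_angular (hg : ContDiff ℝ 1 g) (r θ : ℝ) :
    HasDerivAt (fun θ : ℝ => g (r * Complex.exp (θ * Complex.I)))
      (r * fderiv ℝ g (r * Complex.exp (θ * Complex.I))
        (Complex.I * Complex.exp (θ * Complex.I))) θ := by
  have h1 : HasDerivAt (fun θ : ℝ => (r : ℂ) * Complex.exp (θ * Complex.I))
      (r • (Complex.I * Complex.exp (θ * Complex.I))) θ := by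
    have h2 : HasDerivAt (fun θ : ℝ => (θ : ℂ) * Complex.I) Complex.I θ := by
      simpa using (Complex.ofRealCLM.hasDerivAt (x := θ)).mul_const Complex.I
    have := (h2.cexp).const_mul (r : ℂ)
    simpa [mul_comm] using this
  have h3 := ((hg.differentiable one_ne_zero).differentiableAt.hasFDerivAt).comp_hasDerivAt θ h1
  rw [map_smul, Complex.real_smul] at h3
  exact h3

/-- The integrand is the derivative of g along a ray, and compact support kills the endpoint at
infinity. -/
theorem integral_radial (hg : ContDiff ℝ 1 g) (hc : HasCompactSupport g) (θ : ℝ) :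
    ∫ r in Ioi (0 : ℝ), fderiv ℝ g (r * Complex.exp (θ * Complex.I)) (Complex.exp (θ * Complex.I))
      = -g 0 := by
  set c := Complex.exp (θ * Complex.I)
  have hc0 : c ≠ 0 := Complex.exp_ne_zero _
  have hsmooth : ContDiff ℝ 1 fun r : ℝ => g (r * c) :=
    hg.comp ((Complex.ofRealCLM.contDiff).mul contDiff_const)
  have hemb : Topology.IsClosedEmbedding fun r : ℝ => (r : ℂ) * c :=
    (Homeomorph.mulRight₀ c hc0).isClosedEmbedding.comp Complex.isometry_ofReal.isClosedEmbedding
  have hcs : HasCompactSupport fun r : ℝ => g (r * c) := hc.comp_isClosedEmbedding hemb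
  have := hcs.integral_Ioi_deriv_eq hsmooth 0
  simpa [(hasDerivAt_radial hg c _).deriv] using this

/-- Up to the factor r, the integrand is the θ-derivative of g on a closed circle. -/
theorem integral_angular (hg : ContDiff ℝ 1 g) {r : ℝ} (hr : 0 < r) :
    ∫ θ in Ioo (-Real.pi) Real.pi, fderiv ℝ g (r * Complex.exp (θ * Complex.I))
      (Complex.I * Complex.exp (θ * Complex.I)) = 0 := by
  have hcont : Continuous fun θ : ℝ => (r : ℂ) * fderiv ℝ g (r * Complex.exp (θ * Complex.I))
      (Complex.I * Complex.exp (θ * Complex.I)) := by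
    refine continuous_const.mul (((hg.continuous_fderiv one_ne_zero).comp ?_).clm_apply ?_) <;>
      fun_prop
  have h := intervalIntegral.integral_eq_sub_of_hasDerivAt (a := -Real.pi) (b := Real.pi)
    (fun θ _ => hasDerivAt_angular hg r θ) (hcont.intervalIntegrable _ _)
  rw [intervalIntegral.integral_of_le (by linarith [Real.pi_pos]), integral_Ioc_eq_integral_Ioo,
    integral_const_mul] at h
  have hexp : Complex.exp (((-Real.pi : ℝ) : ℂ) * Complex.I)
      = Complex.exp ((Real.pi : ℂ) * Complex.I) := by
    rw [Complex.exp_pi_mul_I, Complex.ofReal_neg, neg_mul, Complex.exp_neg, Complex.exp_pi_mul_I]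
    norm_num
  rw [hexp, sub_self] at h
  exact (mul_eq_zero.1 h).resolve_left (by exact_mod_cast hr.ne')

theorem integrable_polar_fderiv (hg : ContDiff ℝ 1 g) (hc : HasCompactSupport g) {v : ℝ → ℂ}
    (hv : Continuous v) :
    Integrable (fun p : ℝ × ℝ => fderiv ℝ g (p.1 * Complex.exp (p.2 * Complex.I)) (v p.2))
      ((volume.restrict (Ioi (0 : ℝ))).prod (volume.restrict (Ioo (-Real.pi) Real.pi))) := by
  have hcont : Continuous fun p : ℝ × ℝ =>
      fderiv ℝ g (p.1 * Complex.exp (p.2 * Complex.I)) (v p.2) := by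
    refine ((hg.continuous_fderiv one_ne_zero).comp ?_).clm_apply ?_ <;> fun_prop
  obtain ⟨M, hM⟩ := hc.isCompact.isBounded.exists_norm_le
  rw [Measure.prod_restrict, ← Measure.volume_eq_prod]
  have hK : IsCompact (Icc (0 : ℝ) M ×ˢ Icc (-Real.pi) Real.pi) := isCompact_Icc.prod isCompact_Icc
  have h1 := (hcont.continuousOn (s := Icc (0 : ℝ) M ×ˢ Icc (-Real.pi) Real.pi)).integrableOn_compact
    (μ := volume) hK
  refine h1.of_forall_sdiff_eq_zero (measurableSet_Ioi.prod measurableSet_Ioo) ?_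
  rintro ⟨r, θ⟩ ⟨⟨hr, hθ⟩, hn⟩
  have hr' : M < r := by
    by_contra! hle
    exact hn ⟨⟨le_of_lt hr, hle⟩, ⟨hθ.1.le, hθ.2.le⟩⟩
  have hz : (r : ℂ) * Complex.exp (θ * Complex.I) ∉ tsupport (fderiv ℝ g) := fun hmem => by
    have := hM _ (tsupport_fderiv_subset ℝ hmem)
    rw [norm_mul, Complex.norm_exp_ofReal_mul_I, mul_one, Complex.norm_real,
      Real.norm_of_nonneg (le_of_lt hr)] at this
    linarith
  simp [image_eq_zero_of_notMem_tsupport hz]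

/-- The Cauchy-Pompeiu formula: `1 / (π t)` is a fundamental solution of `∂/∂z̄`. -/
theorem integral_inv_mul_dbar (hg : ContDiff ℝ 1 g) (hc : HasCompactSupport g) :
    ∫ t : ℂ, t⁻¹ * ((fderiv ℝ g t 1 + Complex.I * fderiv ℝ g t Complex.I) / 2)
      = -(Real.pi * g 0) := by
  rw [← Complex.integral_comp_polarCoord_symm]
  have hA := integrable_polar_fderiv hg hc (v := fun θ => Complex.exp (θ * Complex.I))
    (by fun_prop)
  have hB := integrable_polar_fderiv hg hc
    (v := fun θ => Complex.I * Complex.exp (θ * Complex.I)) (by fun_prop)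
  -- With t = re^{iθ}, 2∂/∂t̄ = e^{iθ}(∂_r + (i/r)∂_θ), and the Jacobian r times 1/t is e^{-iθ}: the
  -- singularity and the phase both cancel.
  have hcongr : ∀ p ∈ polarCoord.target,
      p.1 • ((Complex.polarCoord.symm p)⁻¹ * ((fderiv ℝ g (Complex.polarCoord.symm p) 1 +
        Complex.I * fderiv ℝ g (Complex.polarCoord.symm p) Complex.I) / 2)) =
      (1 / 2 : ℂ) * (fderiv ℝ g (p.1 * Complex.exp (p.2 * Complex.I)) (Complex.exp (p.2 * Complex.I))
        + Complex.I * fderiv ℝ g (p.1 * Complex.exp (p.2 * Complex.I))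
          (Complex.I * Complex.exp (p.2 * Complex.I))) := by
    rintro ⟨r, θ⟩ ⟨hr, -⟩
    have hr0 : (r : ℂ) ≠ 0 := by exact_mod_cast (ne_of_gt hr)
    have hsymm : Complex.polarCoord.symm (r, θ) = r * Complex.exp (θ * Complex.I) := by
      simp [Complex.polarCoord_symm_apply, Complex.exp_mul_I]
    rw [hsymm]
    have hlin : ∀ w : ℂ, fderiv ℝ g (r * Complex.exp (θ * Complex.I)) w
        = w.re * fderiv ℝ g (r * Complex.exp (θ * Complex.I)) 1
          + w.im * fderiv ℝ g (r * Complex.exp (θ * Complex.I)) Complex.I := by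
      intro w
      conv_lhs => rw [show w = w.re • (1 : ℂ) + w.im • Complex.I by
        simp [Complex.re_add_im]]
      rw [map_add, map_smul, map_smul]
      simp
    rw [hlin (Complex.exp (θ * Complex.I)), hlin (Complex.I * Complex.exp (θ * Complex.I))]
    generalize fderiv ℝ g (r * Complex.exp (θ * Complex.I)) 1 = a
    generalize fderiv ℝ g (r * Complex.exp (θ * Complex.I)) Complex.I = b
    have hinv : (Complex.exp (θ * Complex.I))⁻¹ = Real.cos θ - Real.sin θ * Complex.I := by
      rw [← Complex.exp_neg, ← neg_mul, Complex.exp_mul_I, Complex.cos_neg, Complex.sin_neg]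
      push_cast
      ring
    simp only [Complex.real_smul, mul_inv, hinv, Complex.exp_ofReal_mul_I_re,
      Complex.exp_ofReal_mul_I_im, Complex.I_mul_re, Complex.I_mul_im]
    push_cast
    field_simp
    ring_nf
    simp only [Complex.I_sq]
    ring
  -- The radial term is integrated in r first, the angular term in θ first; hence the two different
  -- orders of Fubini.
  rw [setIntegral_congr_fun polarCoord.open_target.measurableSet hcongr, polarCoord_target,
    Measure.volume_eq_prod, ← Measure.prod_restrict, integral_const_mul,
    integral_add hA (hB.const_mul _), integral_const_mul, integral_prod_symm _ hA,
    integral_prod _ hB]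
  simp only [integral_radial hg hc]
  rw [setIntegral_congr_fun measurableSet_Ioi (fun r hr => integral_angular hg hr)]
  simp
  rw [max_eq_left (by positivity)]
  push_cast
  ring

end Pompeiu

/-! ### What m ≤ k(p,s) says about exponents, and Hölder -/

/-- The antiderivative (-log r)^{1-a}/(a-1) is monotone and tends to 0 at r = 0. -/
theorem integrableOn_inv_mul_neg_log_rpow {a : ℝ} (ha : 1 < a) :
    IntegrableOn (fun r : ℝ => r⁻¹ * (-Real.log r) ^ (-a)) (Ioo 0 (1 / 2)) := by
  have hlog : ∀ r ∈ Ioo (0 : ℝ) 1, 0 < -Real.log r := fun r hr => by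
    have := Real.log_neg hr.1 hr.2
    linarith
  have hsub : ∀ r ∈ Ioo (0 : ℝ) (1 / 2), 0 < -Real.log r := fun r hr =>
    hlog r ⟨hr.1, hr.2.trans (by norm_num)⟩
  refine (intervalIntegral.integrableOn_deriv_of_nonneg
    (g := fun r => (-Real.log r) ^ (1 - a) / (a - 1)) ?_ ?_ ?_).mono_set Ioo_subset_Ioc_self
  · intro r hr
    rcases hr.1.eq_or_lt with rfl | h0
    · have h1 : Filter.Tendsto (fun r : ℝ => (-Real.log r) ^ (1 - a) / (a - 1)) (nhdsWithin 0 (Ioi 0))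
          (nhds (0 / (a - 1))) := by
        refine Filter.Tendsto.div_const ?_ _
        have := (tendsto_rpow_neg_atTop (y := a - 1) (by linarith)).comp
          (Filter.tendsto_neg_atBot_atTop.comp Real.tendsto_log_nhdsGT_zero)
        simpa [Function.comp_def] using this
      -- The default values log 0 = 0 and 0^{1-a} = 0 agree with the limit, so the antiderivative is
      -- continuous up to 0.
      have h2 : (-Real.log 0) ^ (1 - a) / (a - 1) = 0 / (a - 1) := by
        simp [Real.zero_rpow (show 1 - a ≠ 0 by linarith)]
      have h3 : ContinuousWithinAt (fun r : ℝ => (-Real.log r) ^ (1 - a) / (a - 1)) (Ioi 0) 0 := by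
        rw [ContinuousWithinAt, h2]
        exact h1
      refine (continuousWithinAt_insert_self.2 h3).mono fun x hx => ?_
      rcases hx.1.eq_or_lt with h | h
      · exact Or.inl h.symm
      · exact Or.inr h
    · have h1 := hlog r ⟨h0, hr.2.trans_lt (by norm_num)⟩
      exact (((Real.continuousAt_log h0.ne').neg.rpow_const (Or.inl h1.ne')).div_const
        _).continuousWithinAt
  · intro r hr
    have hneg : HasDerivAt (fun r => -Real.log r) (-r⁻¹) r := (Real.hasDerivAt_log hr.1.ne').neg
    have h := (hneg.rpow_const (p := 1 - a) (Or.inl (hsub r hr).ne')).div_const (a - 1)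
    have : a - 1 ≠ 0 := by linarith
    rw [show 1 - a - 1 = -a by ring] at h
    refine h.congr_deriv ?_
    field_simp
    ring
  · intro r hr
    exact mul_nonneg (inv_nonneg.2 hr.1.le) (Real.rpow_nonneg (hsub r hr).le _)

/-- Up to sign the antiderivative is log(-log r), which is unbounded at 0. -/
theorem not_integrableOn_inv_mul_inv_log :
    ¬ IntegrableOn (fun r : ℝ => r⁻¹ * (-Real.log r)⁻¹) (Ioo 0 (1 / 2)) := by
  have hlog : ∀ᶠ r : ℝ in nhdsWithin 0 (Ioi 0),
      HasDerivAt (fun r => Real.log (-Real.log r)) (-(r⁻¹ * (-Real.log r)⁻¹)) r := by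
    filter_upwards [Ioo_mem_nhdsGT (show (0 : ℝ) < 1 by norm_num)] with r hr
    have h0 : -Real.log r ≠ 0 := by
      have := Real.log_neg hr.1 hr.2
      linarith
    have hneg : HasDerivAt (fun r => -Real.log r) (-r⁻¹) r := (Real.hasDerivAt_log hr.1.ne').neg
    refine (hneg.log h0).congr_deriv ?_
    rw [div_eq_mul_inv, neg_mul]
  refine not_integrableOn_of_tendsto_norm_atTop_of_deriv_isBigO_filter
    (f := fun r => Real.log (-Real.log r)) (nhdsWithin 0 (Ioi 0)) (Ioo_mem_nhdsGT (by norm_num))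
    (hlog.mono fun r h => h.differentiableAt) ?_ ?_
  · exact (Filter.tendsto_abs_atTop_atTop).comp (Real.tendsto_log_atTop.comp
      (Filter.tendsto_neg_atBot_atTop.comp Real.tendsto_log_nhdsGT_zero))
  · refine (Filter.EventuallyEq.isBigO (hlog.mono fun r h => h.deriv)).trans ?_
    exact (Asymptotics.isBigO_refl _ _).neg_left

theorem ae_ne_zero_complex : ∀ᵐ z : ℂ, z ≠ 0 := by simp [ae_iff]

/-- Testing the inclusion that defines `dbarWeightSet` with a radial function. -/
theorem integrableOn_of_mem_dbarWeightSet {p : ℝ≥0∞} {s : ℝ} {k : ℤ} (hk : k ∈ dbarWeightSet p s)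
    {h : ℝ → ℝ} (hh : MemLp (fun z : ℂ => h ‖z‖) p (volume.restrict (Metric.ball 0 (1 / 2)))) :
    IntegrableOn (fun r => r * (r ^ (s - k) * h r)) (Ioo 0 (1 / 2)) := by
  set f : ℂ → ℂ := (Metric.ball (0 : ℂ) (1 / 2)).indicator fun z => ((‖z‖ ^ s * h ‖z‖ : ℝ) : ℂ)
    with hf
  have hmem : MemWeightedLpLoc p s f := by
    intro K hK
    have h1 : MemLp ((Metric.ball (0 : ℂ) (1 / 2)).indicator fun z => ((h ‖z‖ : ℝ) : ℂ)) p := by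
      rw [memLp_indicator_iff_restrict Metric.isOpen_ball.measurableSet]
      exact hh.ofReal
    refine (h1.restrict K).ae_eq ?_
    filter_upwards [ae_restrict_of_ae ae_ne_zero_complex] with z hz
    by_cases hzb : z ∈ Metric.ball (0 : ℂ) (1 / 2)
    · rw [hf, indicator_of_mem hzb, indicator_of_mem hzb, ← Complex.ofReal_mul, ← mul_assoc,
        ← Real.rpow_add (norm_pos_iff.2 hz)]
      simp
    · rw [hf, indicator_of_notMem hzb, indicator_of_notMem hzb, mul_zero]
  have h2 := memLp_one_iff_integrable.1 (hk f hmem _ (isCompact_closedBall (0 : ℂ) (1 / 2)))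
  have h3 : IntegrableOn (fun z : ℂ => ‖z‖ ^ (s - k) * h ‖z‖) (Metric.ball 0 (1 / 2)) := by
    refine (IntegrableOn.mono_set h2 Metric.ball_subset_closedBall).re.congr ?_
    filter_upwards [ae_restrict_of_ae ae_ne_zero_complex,
      ae_restrict_mem Metric.isOpen_ball.measurableSet] with z hz hzb
    rw [hf, indicator_of_mem hzb, ← Complex.ofReal_mul, ← mul_assoc,
      ← Real.rpow_add (norm_pos_iff.2 hz)]
    simp [sub_eq_neg_add]
  rw [integrableOn_fun_norm_addHaar (volume : Measure ℂ) (f := fun r => r ^ (s - k) * h r)] at h3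
  simpa using h3

/-- If s - k < 0, then h = r^{-2-(s-k)} is integrable near 0 in the plane, but the weighted radial
integrand becomes exactly 1/r. -/
theorem sub_nonneg_of_mem_dbarWeightSet_one {s : ℝ} {k : ℤ} (hk : k ∈ dbarWeightSet 1 s) :
    0 ≤ s - k := by
  by_contra! hlt
  have h := integrableOn_of_mem_dbarWeightSet hk (h := fun r => r ^ (-2 - (s - k)))
    (memLp_one_iff_integrable.2 (integrableOn_norm_rpow_ball (by linarith) _))
  have h2 : IntegrableOn (fun r : ℝ => r ^ (-1 : ℝ)) (Ioo 0 (1 / 2)) := by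
    refine h.congr_fun (fun r hr => ?_) measurableSet_Ioo
    simp only
    nth_rewrite 1 [← Real.rpow_one r]
    rw [← Real.rpow_add hr.1, ← Real.rpow_add hr.1]
    congr 1
    ring
  rw [intervalIntegral.integrableOn_Ioo_rpow_iff (by norm_num)] at h2
  linarith

/-- For finite p the test function is r^{-2/p}(-log r)^{-1}: the logarithm puts it in L^p because p
> 1, but if s - k ≤ -2 + 2/p the weighted radial integrand dominates the non-integrable r^{-1}(-log
r)^{-1}. The logarithm is what makes the inequality strict. -/
theorem lt_sub_of_mem_dbarWeightSet {p : ℝ≥0∞} (hp : 1 < p) {s : ℝ} {k : ℤ}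
    (hk : k ∈ dbarWeightSet p s) : -2 + 2 / p.toReal < s - k := by
  -- For p = ∞ the defaults `∞.toReal = 0` and 2/0 = 0 turn the bound into -2 < s - k, which is the
  -- right one; constants suffice as test functions.
  rcases eq_or_ne p ∞ with rfl | hptop
  · have : IsFiniteMeasure (volume.restrict (Metric.ball (0 : ℂ) (1 / 2))) :=
      ⟨by rw [Measure.restrict_apply_univ]; exact measure_ball_lt_top⟩
    have h := integrableOn_of_mem_dbarWeightSet hk (h := fun _ => 1) (memLp_const 1)
    have h2 : IntegrableOn (fun r : ℝ => r ^ (1 + (s - k))) (Ioo 0 (1 / 2)) := by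
      refine h.congr_fun (fun r hr => ?_) measurableSet_Ioo
      simp only
      rw [Real.rpow_add hr.1, Real.rpow_one, mul_one]
    rw [intervalIntegral.integrableOn_Ioo_rpow_iff (by norm_num)] at h2
    simp
    linarith
  have hP : 1 < p.toReal := by
    rw [← ENNReal.toReal_one]
    exact (ENNReal.toReal_lt_toReal ENNReal.one_ne_top hptop).2 hp
  set a := p.toReal
  have hlog : ∀ r ∈ Ioo (0 : ℝ) (1 / 2), 0 < -Real.log r := fun r hr => by
    have := Real.log_neg hr.1 (hr.2.trans (by norm_num))
    linarith
  by_contra! hle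
  have hmeas : Measurable fun z : ℂ => ‖z‖ ^ (-2 / a) * (-Real.log ‖z‖)⁻¹ := by fun_prop
  have h := integrableOn_of_mem_dbarWeightSet hk (h := fun r => r ^ (-2 / a) * (-Real.log r)⁻¹) (by
    rw [← integrable_norm_rpow_iff hmeas.aestronglyMeasurable (zero_lt_one.trans hp).ne' hptop]
    refine (integrableOn_fun_norm_addHaar (volume : Measure ℂ)
      (f := fun r => ‖r ^ (-2 / a) * (-Real.log r)⁻¹‖ ^ a)).2 ?_
    refine (integrableOn_inv_mul_neg_log_rpow hP).congr_fun (fun r hr => ?_) measurableSet_Ioo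
    have hl := hlog r hr
    have hr0 := hr.1
    simp only [Complex.finrank_real_complex, smul_eq_mul]
    rw [Real.norm_of_nonneg (by positivity), Real.mul_rpow (by positivity) (by positivity),
      ← Real.rpow_mul hr.1.le, Real.inv_rpow hl.le, ← Real.rpow_neg hl.le,
      div_mul_cancel₀ _ (by positivity), Real.rpow_neg hr.1.le, ← mul_assoc]
    congr 1
    simp
    field_simp)
  refine not_integrableOn_inv_mul_inv_log (h.mono' ?_ ?_)
  · exact (by fun_prop : Measurable fun r : ℝ => r⁻¹ * (-Real.log r)⁻¹).aestronglyMeasurable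
  · filter_upwards [ae_restrict_mem measurableSet_Ioo] with r hr
    have hl := hlog r hr
    have hr0 := hr.1
    rw [Real.norm_of_nonneg (by positivity), ← mul_assoc, ← mul_assoc]
    refine mul_le_mul_of_nonneg_right ?_ (by positivity)
    nth_rewrite 2 [← Real.rpow_one r]
    rw [← Real.rpow_add hr0, ← Real.rpow_add hr0, ← Real.rpow_neg_one]
    refine Real.rpow_le_rpow_of_exponent_ge hr0 (hr.2.le.trans (by norm_num)) ?_
    have : -2 / a = -(2 / a) := by ring
    linarith

/-- The function `|z|^{s - m}` is in the dual space of `L^p(P)` if `m ≤ k(p, s)`. -/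
theorem memLp_prod_norm_rpow_sub {n : ℕ} {D : Fin n → Set ℂ}
    (hDbdd : ∀ j, Bornology.IsBounded (D j)) {p q : ℝ≥0∞} (hp : 1 ≤ p) [hpq : p.HolderConjugate q]
    {s : Fin n → ℝ} {m : Fin n → ℤ} (hm : ∀ j, m j ≤ dbarWeight p (s j))
    (hDmeas : ∀ j, MeasurableSet (D j)) :
    MemLp (fun z : Fin n → ℂ => ∏ j, ‖z j‖ ^ (s j - m j)) q
      (volume.restrict (Set.univ.pi D)) := by
  have hmeas : Measurable fun z : Fin n → ℂ => ∏ j, ‖z j‖ ^ (s j - m j) :=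
    Finset.measurable_prod _ fun j _ => by fun_prop
  have hk : ∀ j, (m j : ℝ) ≤ dbarWeight p (s j) := fun j => by exact_mod_cast hm j
  have hmax : ∀ j, dbarWeight p (s j) ∈ dbarWeightSet p (s j) := fun j =>
    (dbarWeight_isGreatest p hp (s j)).1
  rcases hp.eq_or_lt with rfl | hp1
  · obtain rfl : q = ∞ := by
      have h := hpq.inv_add_inv_eq_inv
      rw [inv_one] at h
      exact ENNReal.inv_eq_zero.1 ((ENNReal.add_right_inj ENNReal.one_ne_top).1
        (h.trans (add_zero 1).symm))
    choose R hR using fun j => (hDbdd j).exists_norm_le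
    refine memLp_top_of_bound hmeas.aestronglyMeasurable (∏ j, R j ^ (s j - m j)) ?_
    filter_upwards [ae_restrict_mem (MeasurableSet.univ_pi hDmeas)] with z hz
    rw [Real.norm_of_nonneg (by positivity)]
    refine Finset.prod_le_prod (fun j _ => by positivity) fun j _ => ?_
    have := sub_nonneg_of_mem_dbarWeightSet_one (hmax j)
    exact Real.rpow_le_rpow (norm_nonneg _) (hR j _ (hz j trivial)) (by linarith [hk j])
  · have hinv := hpq.inv_add_inv_eq_one
    have hq0 : q ≠ 0 := hpq.symm.ne_zero
    have hqtop : q ≠ ∞ := by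
      rintro rfl
      simp at hinv
      exact hp1.ne' hinv
    have hr : 0 < q.toReal := ENNReal.toReal_pos hq0 hqtop
    have hrel : p.toReal⁻¹ + q.toReal⁻¹ = 1 := by
      rw [← ENNReal.toReal_inv, ← ENNReal.toReal_inv, ← ENNReal.toReal_add _ _, hinv,
        ENNReal.toReal_one]
      · exact ENNReal.inv_ne_top.2 (zero_lt_one.trans hp1).ne'
      · exact ENNReal.inv_ne_top.2 hq0
    rw [← integrable_norm_rpow_iff hmeas.aestronglyMeasurable hq0 hqtop, volume_pi,
      Measure.restrict_pi_pi]
    -- Since -2/q = -2 + 2/p for conjugate exponents, the bound on s - m is precisely integrability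
    -- of |z_j|^{(s_j-m_j)q} at 0.
    have hexp : ∀ j, -2 < (s j - m j) * q.toReal := fun j => by
      have h1 := lt_sub_of_mem_dbarWeightSet hp1 (hmax j)
      have h2 : -2 / q.toReal < s j - m j := by
        have : -2 / q.toReal = -2 + 2 / p.toReal := by
          rw [div_eq_mul_inv, div_eq_mul_inv]
          linarith
        linarith [hk j]
      rwa [div_lt_iff₀ hr] at h2
    refine (Integrable.fintype_prod (μ := fun j => volume.restrict (D j))
      (f := fun j (w : ℂ) => ‖w‖ ^ ((s j - m j) * q.toReal)) fun j => ?_).congr ?_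
    · obtain ⟨R, hR⟩ := (hDbdd j).subset_ball 0
      exact (integrableOn_norm_rpow_ball (hexp j) R).mono_set hR
    · refine Filter.Eventually.of_forall fun z => ?_
      simp only
      rw [Real.norm_of_nonneg (by positivity),
        ← Real.finsetProd_rpow _ _ (fun j _ => by positivity)]
      exact Finset.prod_congr rfl fun j _ => Real.rpow_mul (norm_nonneg _) _ _

theorem ae_forall_ne_zero {n : ℕ} : ∀ᵐ z : Fin n → ℂ, ∀ j, z j ≠ 0 := by
  rw [ae_all_iff]
  intro j
  rw [volume_pi]
  exact (Measure.tendsto_eval_ae_ae (μ := fun _ : Fin n => (volume : Measure ℂ)) (i := j)).eventually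
    ae_ne_zero_complex

/-- Hölder: almost everywhere |z^{-m} ω_J| is the product of |z|^{s-m} and | |z|^{-s} ω_J |. -/
theorem MemWeightedLp.integrableOn_monomialMul {n : ℕ} {D : Fin n → Set ℂ}
    (hDmeas : ∀ j, MeasurableSet (D j)) (hDbdd : ∀ j, Bornology.IsBounded (D j)) {p : ℝ≥0∞}
    (hp : 1 ≤ p) {s : Fin n → ℝ} {m : Fin n → ℤ} (hm : ∀ j, m j ≤ dbarWeight p (s j)) {q : ℕ}
    {ω : DbarForm n} (hω : MemWeightedLp (Set.univ.pi D) p s q ω) (J : Finset (Fin n)) :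
    IntegrableOn (monomialMul (-m) ω J) (Set.univ.pi D) := by
  have hconj : p.HolderConjugate p.conjExponent := .conjExponent hp
  have h1 := (memLp_prod_norm_rpow_sub hDbdd hp (q := p.conjExponent) hm hDmeas).ofReal (K := ℂ)
  have h2 : MemLp _ 1 _ := (hω.2 J).mul h1
  have hne : ∀ᵐ z ∂(volume.restrict (Set.univ.pi D)), ∀ j : Fin n, z j ≠ 0 :=
    ae_restrict_of_ae ae_forall_ne_zero
  have hmeas : Measurable fun z : Fin n → ℂ =>
      ∏ j, (z j ^ (-m j) * ((‖z j‖ ^ s j : ℝ) : ℂ)) := by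
    refine Finset.measurable_prod _ fun j _ => ?_
    have : Measurable fun z : Fin n → ℂ => z j ^ (-m j) := (measurable_pi_apply j).pow_const _
    fun_prop
  refine (memLp_one_iff_integrable.1 h2).mono ?_ ?_
  · refine (hmeas.aestronglyMeasurable.mul (hω.2 J).1).congr ?_
    filter_upwards [hne] with z hz
    simp only [monomialMul, Pi.mul_apply, Pi.neg_apply, Complex.ofReal_prod]
    rw [← mul_assoc, ← Finset.prod_mul_distrib]
    refine congrArg (· * _) (Finset.prod_congr rfl fun j _ => ?_)
    rw [mul_assoc, ← Complex.ofReal_mul, ← Real.rpow_add (norm_pos_iff.2 (hz j))]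
    simp
  · filter_upwards [hne] with z hz
    simp only [monomialMul, Pi.mul_apply, norm_mul, Complex.norm_real, Pi.neg_apply, norm_prod,
      RCLike.norm_ofReal, RCLike.ofReal_prod]
    rw [← mul_assoc, ← Finset.prod_mul_distrib]
    refine le_of_eq (congrArg (· * _) (Finset.prod_congr rfl fun j _ => ?_))
    have hj := norm_pos_iff.2 (hz j)
    rw [norm_zpow, abs_of_nonneg (by positivity), Real.norm_of_nonneg (by positivity),
      ← Real.rpow_add hj, ← Real.rpow_intCast]
    congr 1
    push_cast
    ring

/-! ### The Cauchy transform in one variable, on test functions -/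

section CauchyTransform

variable {n : ℕ}

/-- The convolution of `w`, in the variable with index `e`, with the kernel `-1 / (π t)`. -/
noncomputable def cauchyTransform (e : Fin n) (w : (Fin n → ℂ) → ℂ) (z : Fin n → ℂ) : ℂ :=
  (Real.pi : ℂ)⁻¹ * ∫ t : ℂ, w (z + Pi.single e t) * t⁻¹

theorem isometry_single (e : Fin n) : Isometry fun t : ℂ => (Pi.single e t : Fin n → ℂ) :=
  Isometry.of_dist_eq fun a b => by simp [dist_eq_norm, ← Pi.single_sub, Pi.norm_single]

theorem continuous_add_single (e : Fin n) (z : Fin n → ℂ) :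
    Continuous fun t : ℂ => z + Pi.single e t :=
  continuous_const.add (isometry_single e).continuous

theorem isClosedEmbedding_add_single (e : Fin n) (z : Fin n → ℂ) :
    Topology.IsClosedEmbedding fun t : ℂ => z + Pi.single e t :=
  (Homeomorph.addLeft z).isClosedEmbedding.comp (isometry_single e).isClosedEmbedding

theorem norm_le_of_norm_add_single_le {e : Fin n} {z : Fin n → ℂ} {t : ℂ} {M : ℝ}
    (h : ‖z + Pi.single e t‖ ≤ M) : ‖t‖ ≤ M + ‖z‖ := by
  have h1 : ‖(Pi.single e t : Fin n → ℂ)‖ = ‖t‖ := Pi.norm_single _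
  rw [← h1]
  calc ‖(Pi.single e t : Fin n → ℂ)‖ = ‖(z + Pi.single e t) - z‖ := by simp
    _ ≤ _ := (norm_sub_le _ _).trans (by gcongr)

section Smooth

variable {φ : (Fin n → ℂ) → ℂ}

theorem integrable_add_single_mul_inv (hφ : Continuous φ) (hc : HasCompactSupport φ) (e : Fin n)
    (z : Fin n → ℂ) : Integrable fun t : ℂ => φ (z + Pi.single e t) * t⁻¹ := by
  have h := locallyIntegrable_complex_inv.integrable_smul_left_of_hasCompactSupport
    (g := fun t => φ (z + Pi.single e t)) (hφ.comp (continuous_add_single e z))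
    (hc.comp_isClosedEmbedding (isClosedEmbedding_add_single e z))
  simpa using h

theorem hasFDerivAt_integral_add_single (hφ : ContDiff ℝ 1 φ) (hc : HasCompactSupport φ)
    (e : Fin n) (z : Fin n → ℂ) :
    Integrable (fun t : ℂ => t⁻¹ • fderiv ℝ φ (z + Pi.single e t)) ∧
    HasFDerivAt (fun z => ∫ t : ℂ, φ (z + Pi.single e t) * t⁻¹)
      (∫ t : ℂ, t⁻¹ • fderiv ℝ φ (z + Pi.single e t)) z := by
  obtain ⟨M, hM⟩ := hc.isCompact.isBounded.exists_norm_le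
  obtain ⟨B, hB⟩ := (hc.fderiv ℝ).exists_bound_of_continuous (hφ.continuous_fderiv one_ne_zero)
  have hmeas : AEStronglyMeasurable (fun t : ℂ => t⁻¹ • fderiv ℝ φ (z + Pi.single e t)) := by
    refine measurable_inv.aestronglyMeasurable.smul (Continuous.aestronglyMeasurable ?_)
    exact (hφ.continuous_fderiv one_ne_zero).comp (continuous_add_single e z)
  -- For x within 1 of z, a nonzero derivative at x + t forces |t| ≤ M + |z| + 1; one more unit
  -- makes the ball open.
  set bound : ℂ → ℝ := (Metric.ball (0 : ℂ) (M + ‖z‖ + 2)).indicator fun t => B * ‖t⁻¹‖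
  have hbound_int : Integrable bound := by
    rw [integrable_indicator_iff Metric.isOpen_ball.measurableSet]
    exact (integrableOn_inv_ball _).norm.const_mul B
  have hbound : ∀ t : ℂ, ∀ x ∈ Metric.ball z 1,
      ‖t⁻¹ • fderiv ℝ φ (x + Pi.single e t)‖ ≤ bound t := by
    intro t x hx
    by_cases ht : t ∈ Metric.ball (0 : ℂ) (M + ‖z‖ + 2)
    · simp only [bound, indicator_of_mem ht]
      rw [norm_smul, mul_comm]
      gcongr
      exact hB _
    · simp only [bound, indicator_of_notMem ht]
      have hx' : x + Pi.single e t ∉ tsupport (fderiv ℝ φ) := fun hmem => by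
        refine ht ?_
        have h1 := norm_le_of_norm_add_single_le (hM _ (tsupport_fderiv_subset ℝ hmem))
        have h2 : ‖x‖ ≤ ‖z‖ + 1 := by
          rw [mem_ball_iff_norm] at hx
          linarith [norm_le_norm_add_norm_sub z x, norm_sub_rev x z]
        rw [mem_ball_zero_iff]
        linarith
      rw [norm_smul, image_eq_zero_of_notMem_tsupport hx', norm_zero, mul_zero]
  refine ⟨hbound_int.mono' hmeas (Filter.Eventually.of_forall fun t =>
    hbound t z (Metric.mem_ball_self one_pos)), ?_⟩
  refine hasFDerivAt_integral_of_dominated_of_fderiv_le (bound := bound)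
    (Metric.ball_mem_nhds z one_pos)
    (Filter.Eventually.of_forall fun x =>
      (integrable_add_single_mul_inv hφ.continuous hc e x).aestronglyMeasurable)
    (integrable_add_single_mul_inv hφ.continuous hc e z) hmeas
    (Filter.Eventually.of_forall hbound) hbound_int (Filter.Eventually.of_forall fun t x _ => ?_)
  have h1 := (hφ.differentiable one_ne_zero).differentiableAt.hasFDerivAt (x := x + Pi.single e t)
  have h2 : HasFDerivAt (fun x : Fin n → ℂ => φ (x + Pi.single e t))
      (fderiv ℝ φ (x + Pi.single e t)) x :=
    h1.comp x ((hasFDerivAt_id x).add_const _)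
  exact h2.mul_const t⁻¹

theorem contDiff_cauchyTransform (hφ : ContDiff ℝ ((⊤ : ℕ∞) : WithTop ℕ∞) φ)
    (hc : HasCompactSupport φ) (e : Fin n) :
    ContDiff ℝ ((⊤ : ℕ∞) : WithTop ℕ∞) (cauchyTransform e φ) := by
  refine contDiff_const.mul (contDiff_iff_contDiffAt.2 fun z => ?_)
  obtain ⟨M, hM⟩ := hc.isCompact.isBounded.exists_norm_le
  -- The convolution is evaluated at the constant point 0 of ℂ; all dependence on z goes through the
  -- smooth parameter.
  have h := contDiffOn_convolution_right_with_param_comp (n := ⊤) (μ := (volume : Measure ℂ))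
    (ContinuousLinearMap.mul ℝ ℂ) (v := fun _ : Fin n → ℂ => (0 : ℂ)) (s := Metric.ball z 1)
    contDiffOn_const (f := fun t : ℂ => t⁻¹) (g := fun x t => φ (x - Pi.single e t))
    (k := Metric.closedBall 0 (M + ‖z‖ + 1)) Metric.isOpen_ball (isCompact_closedBall _ _) ?_
    locallyIntegrable_complex_inv ?_
  · refine (h.contDiffAt (Metric.ball_mem_nhds z one_pos)).congr_of_eventuallyEq
      (Filter.Eventually.of_forall fun x => ?_)
    simp only [convolution_def, ContinuousLinearMap.mul_apply', zero_sub]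
    refine integral_congr_ae (Filter.Eventually.of_forall fun t => ?_)
    simp [Pi.single_neg, mul_comm]
  · intro x t hx ht
    refine image_eq_zero_of_notMem_tsupport fun hmem => ht ?_
    rw [sub_eq_add_neg, ← Pi.single_neg] at hmem
    have h1 := norm_le_of_norm_add_single_le (hM _ hmem)
    have h2 : ‖x‖ ≤ ‖z‖ + 1 := by
      rw [mem_ball_iff_norm] at hx
      linarith [norm_le_norm_add_norm_sub z x, norm_sub_rev x z]
    rw [mem_closedBall_zero_iff]
    rw [norm_neg] at h1
    linarith
  · refine ContDiff.contDiffOn (hφ.comp ?_)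
    have : ContDiff ℝ ((⊤ : ℕ∞) : WithTop ℕ∞) fun t : ℂ => (Pi.single e t : Fin n → ℂ) :=
      (ContinuousLinearMap.single ℝ (fun _ : Fin n => ℂ) e).contDiff
    exact contDiff_fst.sub (this.comp contDiff_snd)

theorem dzbar_cauchyTransform (hφ : ContDiff ℝ 1 φ) (hc : HasCompactSupport φ) (e j : Fin n)
    (z : Fin n → ℂ) : dzbar j (cauchyTransform e φ) z = cauchyTransform e (dzbar j φ) z := by
  obtain ⟨hint, hder⟩ := hasFDerivAt_integral_add_single hφ hc e z
  have hder' : HasFDerivAt (cauchyTransform e φ)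
      ((Real.pi : ℂ)⁻¹ • ∫ t : ℂ, t⁻¹ • fderiv ℝ φ (z + Pi.single e t)) z :=
    hder.const_mul (Real.pi : ℂ)⁻¹
  have happ : ∀ v, Integrable fun t : ℂ => fderiv ℝ φ (z + Pi.single e t) v * t⁻¹ := fun v => by
    simpa [mul_comm] using hint.apply_continuousLinearMap v
  unfold dzbar cauchyTransform
  rw [show (fun z => (Real.pi : ℂ)⁻¹ * ∫ t : ℂ, φ (z + Pi.single e t) * t⁻¹)
    = cauchyTransform e φ from rfl, hder'.fderiv]
  simp only [smul_apply, ContinuousLinearMap.integral_apply hint, smul_eq_mul]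
  rw [show (fun t : ℂ => (fderiv ℝ φ (z + Pi.single e t) (Pi.single j 1) +
      Complex.I * fderiv ℝ φ (z + Pi.single e t) (Pi.single j Complex.I)) / 2 * t⁻¹)
    = fun t : ℂ => (fderiv ℝ φ (z + Pi.single e t) (Pi.single j 1) * t⁻¹ +
      Complex.I * (fderiv ℝ φ (z + Pi.single e t) (Pi.single j Complex.I) * t⁻¹)) / 2 by
    ext t; ring, integral_div, integral_add (happ _) ((happ _).const_mul _), integral_const_mul]
  simp only [mul_comm]
  ring

/-- Cauchy-Pompeiu on the complex line through z in the direction of z_e. -/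
theorem cauchyTransform_dzbar (hφ : ContDiff ℝ 1 φ) (hc : HasCompactSupport φ) (e : Fin n)
    (z : Fin n → ℂ) : cauchyTransform e (dzbar e φ) z = -φ z := by
  have hsingle : ContDiff ℝ 1 fun t : ℂ => (Pi.single e t : Fin n → ℂ) :=
    (ContinuousLinearMap.single ℝ (fun _ : Fin n => ℂ) e).contDiff
  have hg : ContDiff ℝ 1 fun t : ℂ => φ (z + Pi.single e t) :=
    hφ.comp (contDiff_const.add hsingle)
  have h := integral_inv_mul_dbar hg (hc.comp_isClosedEmbedding (isClosedEmbedding_add_single e z))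
  have hder : ∀ t : ℂ, fderiv ℝ (fun t : ℂ => φ (z + Pi.single e t)) t
      = (fderiv ℝ φ (z + Pi.single e t)).comp
        (ContinuousLinearMap.single ℝ (fun _ : Fin n => ℂ) e) := fun t =>
    ((hφ.differentiable one_ne_zero).differentiableAt.hasFDerivAt.comp t
      (((ContinuousLinearMap.single ℝ (fun _ : Fin n => ℂ) e).hasFDerivAt).const_add z)).fderiv
  simp only [hder, ContinuousLinearMap.comp_apply, ContinuousLinearMap.single_apply,
    Pi.single_zero, add_zero] at h
  unfold cauchyTransform dzbar
  simp only [mul_comm _ (_⁻¹ : ℂ)]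
  rw [h]
  have : (Real.pi : ℂ) ≠ 0 := by exact_mod_cast Real.pi_ne_zero
  field_simp

end Smooth

end CauchyTransform

/-! ### The Cauchy transform on integrable functions -/

section CauchyTransformIntegrable

variable {n : ℕ} {e : Fin n} {w : (Fin n → ℂ) → ℂ} {P : Set (Fin n → ℂ)} {R : ℝ}

/-- A shear is a translation for each fixed t. Composing with it turns product integrability into
integrability of the convolution integrand. -/
theorem measurePreserving_add_single (e : Fin n) :
    MeasurePreserving (fun p : ℂ × (Fin n → ℂ) => (p.1, p.2 + Pi.single e p.1))
      (volume.prod volume) (volume.prod volume) := by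
  have hs : Measurable fun t : ℂ => (Pi.single e t : Fin n → ℂ) :=
    (isometry_single e).continuous.measurable
  refine (MeasurePreserving.id (volume : Measure ℂ)).skew_product
    (μc := (volume : Measure (Fin n → ℂ))) (μd := volume)
    (g := fun (t : ℂ) (z : Fin n → ℂ) => z + Pi.single e t) ?_ ?_
  · exact measurable_snd.add (hs.comp measurable_fst)
  · exact Filter.Eventually.of_forall fun t => map_add_right_eq_self volume (Pi.single e t : Fin n → ℂ)

theorem integrable_kernel_mul_add_single (hw : Integrable w) {k : ℂ → ℂ} (hk : Integrable k)
    (e : Fin n) :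
    Integrable (fun p : ℂ × (Fin n → ℂ) => k p.1 * w (p.2 + Pi.single e p.1))
      (volume.prod volume) :=
  (measurePreserving_add_single e).integrable_comp_of_integrable (hk.mul_prod hw)

/-- The Cauchy kernel, cut off at radius `R`. -/
noncomputable def truncatedInv (R : ℝ) : ℂ → ℂ := (Metric.ball 0 R).indicator fun t => t⁻¹

theorem integrable_truncatedInv (R : ℝ) : Integrable (truncatedInv R) := by
  rw [truncatedInv, integrable_indicator_iff Metric.isOpen_ball.measurableSet]
  exact integrableOn_inv_ball R

/-- The kernel 1/t is not integrable on ℂ, but between points of P only |t| < R matters, so an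
integrable kernel can replace it in Fubini arguments. -/
theorem truncatedInv_mul_add_single (hw0 : ∀ z ∉ P, w z = 0)
    (hR : ∀ z ∈ P, ∀ t : ℂ, z + Pi.single e t ∈ P → ‖t‖ < R) {z : Fin n → ℂ} (hz : z ∈ P) (t : ℂ) :
    truncatedInv R t * w (z + Pi.single e t) = w (z + Pi.single e t) * t⁻¹ := by
  by_cases ht : z + Pi.single e t ∈ P
  · rw [truncatedInv, indicator_of_mem (mem_ball_zero_iff.2 (hR z hz t ht)), mul_comm]
  · simp [hw0 _ ht]

theorem ae_integrable_cauchyTransform (hw : Integrable w) (hw0 : ∀ z ∉ P, w z = 0)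
    (hP : MeasurableSet P) (hR : ∀ z ∈ P, ∀ t : ℂ, z + Pi.single e t ∈ P → ‖t‖ < R) :
    ∀ᵐ z ∂(volume.restrict P), Integrable fun t : ℂ => w (z + Pi.single e t) * t⁻¹ := by
  have h := (integrable_kernel_mul_add_single hw (integrable_truncatedInv R) e).prod_left_ae
  filter_upwards [ae_restrict_of_ae h, ae_restrict_mem hP] with z hz hzP
  simpa only [truncatedInv_mul_add_single hw0 hR hzP] using hz

theorem integrableOn_cauchyTransform (hw : Integrable w) (hw0 : ∀ z ∉ P, w z = 0)
    (hP : MeasurableSet P) (hR : ∀ z ∈ P, ∀ t : ℂ, z + Pi.single e t ∈ P → ‖t‖ < R) :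
    IntegrableOn (cauchyTransform e w) P := by
  have h := (integrable_kernel_mul_add_single hw (integrable_truncatedInv R) e).integral_prod_right
  refine (h.const_mul (Real.pi : ℂ)⁻¹).integrableOn.congr_fun (fun z hz => ?_) hP
  simp only [truncatedInv_mul_add_single hw0 hR hz, cauchyTransform]

theorem integral_kernel_mul_add_single (hw : Integrable w) {k : ℂ → ℂ} (hk : Integrable k)
    (e : Fin n) {φ : (Fin n → ℂ) → ℂ} (hφ : Continuous φ) {B : ℝ} (hB : ∀ z, ‖φ z‖ ≤ B) :
    ∫ z, ∫ t, (k t * w (z + Pi.single e t)) * φ z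
      = ∫ z, ∫ t, (k t * w z) * φ (z - Pi.single e t) := by
  have hs : Continuous fun t : ℂ => (Pi.single e t : Fin n → ℂ) := (isometry_single e).continuous
  have hint1 : Integrable (fun p : ℂ × (Fin n → ℂ) =>
      (k p.1 * w (p.2 + Pi.single e p.1)) * φ p.2) (volume.prod volume) :=
    (integrable_kernel_mul_add_single hw hk e).mul_bdd (c := B)
      (hφ.comp continuous_snd).aestronglyMeasurable (Filter.Eventually.of_forall fun p => hB _)
  have hint2 : Integrable (fun p : ℂ × (Fin n → ℂ) =>
      (k p.1 * w p.2) * φ (p.2 - Pi.single e p.1)) (volume.prod volume) :=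
    (hk.mul_prod hw).mul_bdd (c := B)
      (hφ.comp (continuous_snd.sub (hs.comp continuous_fst))).aestronglyMeasurable
      (Filter.Eventually.of_forall fun p => hB _)
  have h1 : ∫ t, ∫ z, (k t * w (z + Pi.single e t)) * φ z
      = ∫ z, ∫ t, (k t * w (z + Pi.single e t)) * φ z := integral_integral_swap hint1
  have h2 : ∫ t, ∫ z, (k t * w z) * φ (z - Pi.single e t)
      = ∫ z, ∫ t, (k t * w z) * φ (z - Pi.single e t) := integral_integral_swap hint2
  rw [← h1, ← h2]
  -- After Fubini, for fixed t, the two inner integrals differ by a translation in z.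
  refine integral_congr_ae (Filter.Eventually.of_forall fun t => ?_)
  beta_reduce
  generalize (Pi.single e t : Fin n → ℂ) = v
  have := integral_add_right_eq_self (μ := (volume : Measure (Fin n → ℂ)))
    (fun z => (k t * w z) * φ (z - v)) v
  simp only [add_sub_cancel_right] at this
  exact this

theorem truncatedInv_neg (R : ℝ) (t : ℂ) : truncatedInv R (-t) = -truncatedInv R t := by
  simp only [truncatedInv, indicator, mem_ball_zero_iff, norm_neg, inv_neg]
  split_ifs <;> simp

/-- The Cauchy transform is skew-symmetric. -/
theorem setIntegral_cauchyTransform_mul (hw : Integrable w) (hw0 : ∀ z ∉ P, w z = 0)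
    (hR : ∀ z ∈ P, ∀ t : ℂ, z + Pi.single e t ∈ P → ‖t‖ < R)
    {φ : (Fin n → ℂ) → ℂ} (hφ : Continuous φ) (hc : HasCompactSupport φ)
    (hφP : ∀ z ∉ P, φ z = 0) :
    ∫ z in P, cauchyTransform e w z * φ z = -∫ z, w z * cauchyTransform e φ z := by
  obtain ⟨B, hB⟩ := hc.exists_bound_of_continuous hφ
  have hl : ∫ z in P, cauchyTransform e w z * φ z
      = (Real.pi : ℂ)⁻¹ * ∫ z, ∫ t, (truncatedInv R t * w (z + Pi.single e t)) * φ z := by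
    rw [← integral_const_mul,
      setIntegral_eq_integral_of_forall_compl_eq_zero fun z hz => by simp [hφP z hz]]
    refine integral_congr_ae (Filter.Eventually.of_forall fun z => ?_)
    by_cases hz : z ∈ P
    · simp only [integral_mul_const, truncatedInv_mul_add_single hw0 hR hz, cauchyTransform]
      ring
    · simp [hφP z hz]
  have hr : ∫ z, w z * cauchyTransform e φ z
      = -((Real.pi : ℂ)⁻¹ * ∫ z, ∫ t, (truncatedInv R t * w z) * φ (z - Pi.single e t)) := by
    rw [← integral_const_mul, ← integral_neg]
    refine integral_congr_ae (Filter.Eventually.of_forall fun z => ?_)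
    by_cases hz : z ∈ P
    -- The substitution t ↦ -t and the oddness of the kernel produce the minus sign.
    · set F : ℂ → ℂ := fun t => φ (z + Pi.single e t) * t⁻¹ with hF
      have h1 : ∀ t, (truncatedInv R t * w z) * φ (z - Pi.single e t) = -(w z * F (-t)) := fun t => by
        rw [hF]
        simp only
        rw [← truncatedInv_mul_add_single hφP hR hz (-t), Pi.single_neg, ← sub_eq_add_neg,
          truncatedInv_neg]
        ring
      simp only [h1, cauchyTransform]
      rw [integral_neg, integral_const_mul, integral_neg_eq_self F volume]
      ring
    · simp [hw0 z hz]
  rw [hl, hr, neg_neg, integral_kernel_mul_add_single hw (integrable_truncatedInv R) e hφ hB]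

end CauchyTransformIntegrable

/-! ### Signs of wedge products -/

section WedgeSign

variable {n : ℕ}

theorem wedgeSign_mul_self (j : Fin n) (J : Finset (Fin n)) : wedgeSign j J * wedgeSign j J = 1 := by
  rw [wedgeSign, ← mul_pow]
  norm_num

theorem wedgeSign_insert {i j : Fin n} {J : Finset (Fin n)} (hi : i ∉ J) :
    wedgeSign j (insert i J) = if i < j then -wedgeSign j J else wedgeSign j J := by
  unfold wedgeSign
  rw [Finset.filter_insert]
  split_ifs with h
  · rw [Finset.card_insert_of_notMem (fun hmem => hi (Finset.mem_filter.1 hmem).1), pow_succ]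
    ring
  · rfl

/-- The anticommutation `dz̄_i ∧ dz̄_j = - dz̄_j ∧ dz̄_i`. -/
theorem wedgeSign_insert_mul {i j : Fin n} {J : Finset (Fin n)} (hij : i ≠ j) (hi : i ∉ J)
    (hj : j ∉ J) :
    wedgeSign j (insert i J) * wedgeSign i J = -(wedgeSign i (insert j J) * wedgeSign j J) := by
  rw [wedgeSign_insert hi, wedgeSign_insert hj]
  rcases lt_or_gt_of_ne hij with h | h
  · rw [if_pos h, if_neg h.not_gt]
    ring
  · rw [if_neg h.not_gt, if_pos h]
    ring

end WedgeSign

/-! ### Test functions and cutoffs -/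

section TestFunctions

variable {n : ℕ} {φ : (Fin n → ℂ) → ℂ}

theorem continuous_dzbar (hφ : ContDiff ℝ 1 φ) (j : Fin n) : Continuous (dzbar j φ) := by
  have h := fun v => (hφ.continuous_fderiv one_ne_zero).clm_apply (continuous_const (y := v))
  exact ((h _).add (continuous_const.mul (h _))).div_const _

theorem dzbar_eq_zero_of_notMem_tsupport {z : Fin n → ℂ} (hz : z ∉ tsupport φ) (j : Fin n) :
    dzbar j φ z = 0 := by
  have : fderiv ℝ φ z = 0 :=
    image_eq_zero_of_notMem_tsupport fun h => hz (tsupport_fderiv_subset ℝ h)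
  simp [dzbar, this]

theorem hasCompactSupport_dzbar (hc : HasCompactSupport φ) (j : Fin n) :
    HasCompactSupport (dzbar j φ) :=
  HasCompactSupport.intro hc.isCompact fun _ hz => dzbar_eq_zero_of_notMem_tsupport hz j

theorem dzbar_congr {ψ : (Fin n → ℂ) → ℂ} {z : Fin n → ℂ} (h : φ =ᶠ[nhds z] ψ) (j : Fin n) :
    dzbar j φ z = dzbar j ψ z := by
  simp [dzbar, h.fderiv_eq]

theorem exists_cutoff {K U : Set ℂ} (hK : IsCompact K) (hU : IsOpen U) (hKU : K ⊆ U) :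
    ∃ χ : ℂ → ℝ, ContDiff ℝ ((⊤ : ℕ∞) : WithTop ℕ∞) χ ∧ HasCompactSupport χ ∧ tsupport χ ⊆ U ∧
      ∀ t ∈ K, ∀ᶠ x in nhds t, χ x = 1 := by
  obtain ⟨L, hL, hKL, hLU⟩ := exists_compact_between hK hU hKU
  obtain ⟨f, hf1, hf0, -⟩ := exists_contMDiffMap_one_nhds_of_subset_interior (n := ⊤)
    (modelWithCornersSelf ℝ ℂ) hK.isClosed hKL
  have hsupp : tsupport f ⊆ L :=
    closure_minimal (fun x hx => by_contra fun h => hx (hf0 x h)) hL.isClosed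
  exact ⟨f, f.contMDiff.contDiff, hL.of_isClosed_subset (isClosed_tsupport _) hsupp,
    hsupp.trans hLU, fun t ht => (eventually_nhdsSet_iff_forall.1 hf1) t ht⟩

/-- The transform spreads the support only along z_e, so a cutoff χ(z_e) with χ = 1 near K suffices.
Agreement on neighbourhoods makes the derivatives agree too. -/
theorem exists_test_function_eq_cauchyTransform {D : Fin n → Set ℂ} {e : Fin n}
    (hDe : IsOpen (D e)) {K : Set ℂ} (hK : IsCompact K) (hKD : K ⊆ D e)
    (hφ : ContDiff ℝ ((⊤ : ℕ∞) : WithTop ℕ∞) φ) (hc : HasCompactSupport φ)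
    (hφD : tsupport φ ⊆ Set.univ.pi D) :
    ∃ ψ : (Fin n → ℂ) → ℂ, ContDiff ℝ ((⊤ : ℕ∞) : WithTop ℕ∞) ψ ∧ HasCompactSupport ψ ∧
      tsupport ψ ⊆ Set.univ.pi D ∧ ∀ z, z e ∈ K → ψ =ᶠ[nhds z] cauchyTransform e φ := by
  obtain ⟨χ, hχ, hχc, hχU, hχ1⟩ := exists_cutoff hK hDe hKD
  -- This compact box lies in P because P is a product: each factor is a compact subset of D_j.
  set A : Fin n → Set ℂ := fun j => if j = e then tsupport χ else (fun z => z j) '' tsupport φ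
  have hA : IsCompact (Set.univ.pi A) := isCompact_univ_pi fun j => by
    by_cases hj : j = e
    · simpa [A, hj] using hχc.isCompact
    · simpa [A, hj] using hc.isCompact.image (continuous_apply j)
  have hAD : Set.univ.pi A ⊆ Set.univ.pi D := Set.pi_mono fun j _ => by
    by_cases hj : j = e
    · subst hj
      simpa [A] using hχU
    · simp only [A, hj, if_false]
      rintro _ ⟨z, hz, rfl⟩
      exact hφD hz j trivial
  have hsupp : tsupport (fun z : Fin n → ℂ => (χ (z e) : ℂ) * cauchyTransform e φ z)
      ⊆ Set.univ.pi A := by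
    refine closure_minimal (fun z hz => ?_) hA.isClosed
    have h1 : χ (z e) ≠ 0 := fun h => hz (by simp [h])
    have h2 : cauchyTransform e φ z ≠ 0 := fun h => hz (by simp [h])
    obtain ⟨t, ht⟩ : ∃ t : ℂ, φ (z + Pi.single e t) ≠ 0 := by
      by_contra! h
      exact h2 (by simp [cauchyTransform, h])
    intro j _
    by_cases hj : j = e
    · subst hj
      simpa [A] using subset_tsupport _ h1
    · simp only [A, hj, if_false]
      exact ⟨_, subset_tsupport _ ht, by simp [hj]⟩
  refine ⟨fun z => (χ (z e) : ℂ) * cauchyTransform e φ z, ?_, ?_, hsupp.trans hAD, ?_⟩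
  · refine ContDiff.mul ?_ (contDiff_cauchyTransform hφ hc e)
    exact Complex.ofRealCLM.contDiff.comp (hχ.comp (contDiff_apply ℝ ℂ e))
  · exact hA.of_isClosed_subset (isClosed_tsupport _) hsupp
  · intro z hz
    have := (continuous_apply e).continuousAt.eventually (hχ1 (z e) hz)
    filter_upwards [this] with x hx
    simp [hx]

end TestFunctions

/-! ### The unweighted homotopy formula -/

section WeakDbar

variable {n : ℕ} {P : Set (Fin n → ℂ)} {u v : DbarForm n}

theorem IsWeakDbar.congr {u' v' : DbarForm n} (h : IsWeakDbar P u v)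
    (hu : ∀ J, u J =ᵐ[volume.restrict P] u' J) (hv : ∀ J, v J =ᵐ[volume.restrict P] v' J) :
    IsWeakDbar P u' v' := by
  intro L φ hφ hc hP
  have h1 : ∀ (w w' : (Fin n → ℂ) → ℂ) (ψ : (Fin n → ℂ) → ℂ), w =ᵐ[volume.restrict P] w' →
      ∫ z in P, w' z * ψ z = ∫ z in P, w z * ψ z := fun w w' ψ hw =>
    integral_congr_ae (hw.mono fun z hz => by simp only [hz])
  simp only [h1 _ _ _ (hu _), h1 _ _ _ (hv _)]
  exact h L φ hφ hc hP

/-- The support of `∂̄u` is contained in the support of `u`. -/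
theorem IsWeakDbar.ae_eq_zero (hP : IsOpen P) (h : IsWeakDbar P u v)
    (hv : ∀ J, LocallyIntegrableOn (v J) P) {C : Set (Fin n → ℂ)} (hC : IsClosed C)
    (hu : ∀ J, ∀ᵐ z ∂(volume.restrict P), z ∉ C → u J z = 0) (L : Finset (Fin n)) :
    ∀ᵐ z ∂(volume.restrict P), z ∉ C → v L z = 0 := by
  have hU : IsOpen (P ∩ Cᶜ) := hP.inter hC.isOpen_compl
  have key := hU.ae_eq_zero_of_integral_contDiff_smul_eq_zero (μ := volume)
    ((hv L).mono_set inter_subset_left) (fun g hg hgc hgU => by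
      set φ : (Fin n → ℂ) → ℂ := fun z => (g z : ℂ)
      have hts : tsupport φ ⊆ tsupport g :=
        closure_mono fun z hz hgz => hz (by simp [φ, hgz])
      have hφ : ContDiff ℝ ((⊤ : ℕ∞) : WithTop ℕ∞) φ := Complex.ofRealCLM.contDiff.comp hg
      have hφc : HasCompactSupport φ := hgc.of_isClosed_subset (isClosed_tsupport _) hts
      have h1 := h L φ hφ hφc (hts.trans (hgU.trans inter_subset_left))
      have h2 : ∀ J j, ∫ z in P, u J z * dzbar j φ z = 0 := fun J j => by
        refine integral_eq_zero_of_ae ((hu J).mono fun z hz => ?_)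
        by_cases hzC : z ∈ C
        · have : z ∉ tsupport φ := fun hmem => (hgU (hts hmem)).2 hzC
          simp [dzbar_eq_zero_of_notMem_tsupport this]
        · simp [hz hzC]
      simp only [h2, neg_zero, mul_zero, Finset.sum_const_zero] at h1
      rw [setIntegral_eq_integral_of_forall_compl_eq_zero fun z hz => ?_] at h1
      · rw [h1]
        exact integral_congr_ae (Filter.Eventually.of_forall fun z => by simp [φ, mul_comm])
      · have : z ∉ tsupport φ := fun hmem => hz (hgU (hts hmem)).1
        rw [image_eq_zero_of_notMem_tsupport this, mul_zero])
  filter_upwards [ae_restrict_of_ae key, ae_restrict_mem hP.measurableSet] with z hz hzP hzC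
  exact hz ⟨hzP, hzC⟩

/-- The Cauchy operator in the variable with index `e`, without weights. -/
noncomputable def cauchyForm (P : Set (Fin n → ℂ)) (e : Fin n) (u : DbarForm n) : DbarForm n :=
  fun J z => if e ∈ J then 0
    else -(wedgeSign e J * cauchyTransform e (P.indicator (u (insert e J))) z)

variable {e : Fin n} {R : ℝ}

theorem integrableOn_cauchyForm (hP : MeasurableSet P) (hu : ∀ J, IntegrableOn (u J) P)
    (hR : ∀ z ∈ P, ∀ t : ℂ, z + Pi.single e t ∈ P → ‖t‖ < R) (J : Finset (Fin n)) :
    IntegrableOn (cauchyForm P e u J) P := by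
  by_cases he : e ∈ J
  · have h : cauchyForm P e u J = fun _ => 0 := by
      ext z
      simp [cauchyForm, he]
    rw [h]
    exact integrableOn_zero
  · have h : cauchyForm P e u J = fun z =>
        -(wedgeSign e J * cauchyTransform e (P.indicator (u (insert e J))) z) := by
      ext z
      simp [cauchyForm, he]
    rw [h]
    exact ((integrableOn_cauchyTransform ((integrable_indicator_iff hP).2 (hu _))
      (fun z hz => indicator_of_notMem hz _) hP hR).const_mul _).neg

/-- Skew-symmetry of the Cauchy transform; its minus sign cancels the one in `cauchyForm`. -/
theorem setIntegral_cauchyForm_mul (hP : MeasurableSet P) (hu : ∀ J, IntegrableOn (u J) P)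
    (hR : ∀ z ∈ P, ∀ t : ℂ, z + Pi.single e t ∈ P → ‖t‖ < R)
    {φ : (Fin n → ℂ) → ℂ} (hφ : Continuous φ) (hc : HasCompactSupport φ) (hφP : ∀ z ∉ P, φ z = 0)
    {J : Finset (Fin n)} (he : e ∉ J) :
    ∫ z in P, cauchyForm P e u J z * φ z
      = wedgeSign e J * ∫ z in P, u (insert e J) z * cauchyTransform e φ z := by
  have h := setIntegral_cauchyTransform_mul (e := e) ((integrable_indicator_iff hP).2 (hu (insert e J)))
    (fun z hz => indicator_of_notMem hz _) hR hφ hc hφP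
  simp only [cauchyForm, he, if_false, neg_mul, mul_assoc]
  rw [integral_neg, integral_const_mul, h, mul_neg, neg_neg, ← integral_indicator hP]
  simp only [indicator_mul_left]

/-- The Cauchy-Pompeiu homotopy formula without weights. -/
theorem IsWeakDbar.cauchyForm {D : Fin n → Set ℂ} (hD : ∀ j, IsOpen (D j))
    (hR : ∀ z ∈ Set.univ.pi D, ∀ t : ℂ, z + Pi.single e t ∈ Set.univ.pi D → ‖t‖ < R)
    (hu : ∀ J, IntegrableOn (u J) (Set.univ.pi D)) (hv : ∀ J, IntegrableOn (v J) (Set.univ.pi D))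
    (h : IsWeakDbar (Set.univ.pi D) u v) {K : Set ℂ} (hK : IsCompact K) (hKD : K ⊆ D e)
    (hsupp : ∀ J, ∀ᵐ z ∂(volume.restrict (Set.univ.pi D)), z e ∉ K → u J z = 0) :
    IsWeakDbar (Set.univ.pi D) (cauchyForm (Set.univ.pi D) e u)
      (u - cauchyForm (Set.univ.pi D) e v) := by
  set P := Set.univ.pi D
  have hPo : IsOpen P := isOpen_set_pi finite_univ fun j _ => hD j
  have hPm := hPo.measurableSet
  have hsuppv : ∀ J, ∀ᵐ z ∂(volume.restrict P), z e ∉ K → v J z = 0 :=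
    h.ae_eq_zero hPo (fun J => (hv J).locallyIntegrableOn)
      (hK.isClosed.preimage (continuous_apply e)) hsupp
  intro L φ hφ hc hφP
  have hφ1 : ContDiff ℝ 1 φ := hφ.of_le (by exact_mod_cast le_top)
  obtain ⟨B, hB⟩ := hc.exists_bound_of_continuous hφ.continuous
  have hmul : ∀ w : (Fin n → ℂ) → ℂ, IntegrableOn w P → IntegrableOn (fun z => w z * φ z) P :=
    fun w hw => hw.mul_bdd (c := B) hφ.continuous.aestronglyMeasurable
      (Filter.Eventually.of_forall hB)
  have hzero : ∀ z ∉ P, φ z = 0 := fun z hz =>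
    image_eq_zero_of_notMem_tsupport fun hmem => hz (hφP hmem)
  have hTu : ∀ (j : Fin n) {J : Finset (Fin n)}, e ∉ J →
      ∫ z in P, _root_.cauchyForm P e u J z * dzbar j φ z
        = wedgeSign e J * ∫ z in P, u (insert e J) z * cauchyTransform e (dzbar j φ) z :=
    fun j J he => setIntegral_cauchyForm_mul hPm hu hR (continuous_dzbar hφ1 j)
      (hasCompactSupport_dzbar hc j)
      (fun z hz => dzbar_eq_zero_of_notMem_tsupport (fun hmem => hz (hφP hmem)) j) he
  have hsplit : ∫ z in P, (u - _root_.cauchyForm P e v) L z * φ z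
      = (∫ z in P, u L z * φ z) - ∫ z in P, _root_.cauchyForm P e v L z * φ z := by
    rw [← integral_sub (hmul _ (hu L)) (hmul _ (integrableOn_cauchyForm hPm hv hR L))]
    simp only [Pi.sub_apply, sub_mul]
  rw [hsplit]
  -- If e ∈ L, only j = e contributes, since coefficients of `cauchyForm` containing e vanish;
  -- Cauchy-Pompeiu then gives u_L.
  by_cases he : e ∈ L
  · rw [Finset.sum_eq_single_of_mem e he, hTu e (Finset.notMem_erase e L), Finset.insert_erase he]
    · simp only [cauchyTransform_dzbar hφ1 hc, _root_.cauchyForm, he, if_true, zero_mul,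
        integral_zero, sub_zero, mul_neg, integral_neg, neg_neg]
      rw [← mul_assoc, wedgeSign_mul_self, one_mul]
    · intro j _ hj
      simp [_root_.cauchyForm, Finset.mem_erase, he, hj.symm]
  -- If e ∉ L, the equation ∂̄u = v is tested in the coefficient L ∪ {e} on the cut-off transform of
  -- φ. The term j = e yields u_L, the terms j ∈ L yield ∂̄ of the transformed u, and v yields its
  -- own transform.
  · obtain ⟨ψ, hψ, hψc, hψP, hψeq⟩ :=
      exists_test_function_eq_cauchyTransform (hD e) hK hKD hφ hc hφP
    have hH := h (insert e L) ψ hψ hψc hψP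
    have h1 : ∀ J j, ∫ z in P, u J z * dzbar j ψ z
        = ∫ z in P, u J z * cauchyTransform e (dzbar j φ) z := fun J j => by
      refine integral_congr_ae ((hsupp J).mono fun z hz => ?_)
      by_cases hzK : z e ∈ K
      · simp only [dzbar_congr (hψeq z hzK), dzbar_cauchyTransform hφ1 hc]
      · simp [hz hzK]
    have h2 : ∫ z in P, v (insert e L) z * ψ z
        = ∫ z in P, v (insert e L) z * cauchyTransform e φ z := by
      refine integral_congr_ae ((hsuppv (insert e L)).mono fun z hz => ?_)
      by_cases hzK : z e ∈ K
      · simp only [(hψeq z hzK).self_of_nhds]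
      · simp [hz hzK]
    rw [Finset.sum_insert he, Finset.erase_insert he, h2] at hH
    simp only [h1] at hH
    simp only [cauchyTransform_dzbar hφ1 hc, mul_neg, integral_neg, neg_neg] at hH
    rw [setIntegral_cauchyForm_mul hPm hv hR hφ.continuous hc hzero he, ← hH, mul_add, ← mul_assoc,
      wedgeSign_mul_self, one_mul, sub_add_cancel_left, Finset.mul_sum, ← Finset.sum_neg_distrib]
    refine Finset.sum_congr rfl fun j hj => ?_
    have hje : e ≠ j := fun hej => he (hej ▸ hj)
    have heJ : e ∉ L.erase j := fun hmem => he (Finset.mem_of_mem_erase hmem)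
    rw [hTu j heJ, Finset.erase_insert_of_ne hje]
    have hsign := wedgeSign_insert_mul hje heJ (Finset.notMem_erase j L)
    rw [Finset.insert_erase hj] at hsign
    have hs1 := wedgeSign_mul_self e L
    have hs2 := wedgeSign_mul_self e (L.erase j)
    generalize (∫ z in P, u (insert e (L.erase j)) z * cauchyTransform e (dzbar j φ) z) = X
    linear_combination (-(wedgeSign e L * wedgeSign e (L.erase j)) * X) * hsign +
      (wedgeSign j (L.erase j) * wedgeSign e (L.erase j) * X) * hs1 +
      (wedgeSign e L * wedgeSign j (insert e (L.erase j)) * X) * hs2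

end WeakDbar

/-! ### Removing the weights from the Cauchy operator -/

section WeightedCauchyOp

variable {n : ℕ} {D : Fin n → Set ℂ} {e : Fin n} {m : Fin n → ℤ} {J : Finset (Fin n)}

/-- With ζ = z_e + t, the factors z_e^{-m_e} and z_e^{m_e} cancel, ζ^{-m_e} comes from the
integrand, and the remaining factors of z^{-m} do not depend on ζ. -/
theorem monomial_mul_cauchyIntegrand (ω : DbarForm n) {z : Fin n → ℂ} (hz : z ∈ Set.univ.pi D)
    (hze : z e ≠ 0) (t : ℂ) :
    ((∏ j, z j ^ (-m j)) * z e ^ m e) *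
        (D e).indicator (cauchyIntegrand e (m e) ω J z) (t + z e) =
      wedgeSign e J * ((Set.univ.pi D).indicator (monomialMul (-m) ω (insert e J))
        (z + Pi.single e t) * t⁻¹) := by
  have hupd : z + Pi.single e t = Function.update z e (t + z e) := by
    ext j
    by_cases hj : j = e
    · subst hj
      simp [add_comm]
    · simp [hj]
  have hmem : Function.update z e (t + z e) ∈ Set.univ.pi D ↔ t + z e ∈ D e :=
    Set.update_mem_pi_iff_of_mem hz |>.trans (by simp)
  rw [hupd]
  by_cases ht : t + z e ∈ D e
  · rw [indicator_of_mem ht, indicator_of_mem (hmem.2 ht)]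
    have hprod : ∀ y : Fin n → ℂ, ∏ j, y j ^ (-m j)
        = y e ^ (-m e) * ∏ j ∈ Finset.univ.erase e, y j ^ (-m j) := fun y =>
      (Finset.mul_prod_erase Finset.univ _ (Finset.mem_univ e)).symm
    have hcongr : ∏ j ∈ Finset.univ.erase e, Function.update z e (t + z e) j ^ (-m j)
        = ∏ j ∈ Finset.univ.erase e, z j ^ (-m j) :=
      Finset.prod_congr rfl fun j hj => by rw [Function.update_of_ne (Finset.ne_of_mem_erase hj)]
    have hcancel : z e ^ (-m e) * z e ^ m e = 1 := by
      rw [← zpow_add₀ hze, neg_add_cancel, zpow_zero]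
    simp only [monomialMul, Pi.neg_apply, cauchyIntegrand]
    rw [hprod, hprod (Function.update z e (t + z e)), hcongr, Function.update_self,
      add_sub_cancel_right, zpow_neg (t + z e), div_eq_mul_inv, mul_inv]
    generalize (∏ j ∈ Finset.univ.erase e, z j ^ (-m j)) = A
    generalize ω (insert e J) (Function.update z e (t + z e)) = B
    generalize ((t + z e) ^ m e)⁻¹ = C
    linear_combination (A * (wedgeSign e J * B * (C * t⁻¹))) * hcancel
  · rw [indicator_of_notMem ht, indicator_of_notMem (fun h => ht (hmem.1 h))]
    simp

theorem ae_ne_zero_and_mem (hD : ∀ j, IsOpen (D j)) :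
    ∀ᵐ z ∂(volume.restrict (Set.univ.pi D)), (∀ j, z j ≠ 0) ∧ z ∈ Set.univ.pi D :=
  (ae_restrict_of_ae ae_forall_ne_zero).and
    (ae_restrict_mem (MeasurableSet.univ_pi fun j => (hD j).measurableSet))

theorem monomialMul_cauchyOp_ae_eq (hD : ∀ j, IsOpen (D j)) (ω : DbarForm n) :
    monomialMul (-m) (cauchyOp (D e) e (m e) ω) J =ᵐ[volume.restrict (Set.univ.pi D)]
      cauchyForm (Set.univ.pi D) e (monomialMul (-m) ω) J := by
  filter_upwards [ae_ne_zero_and_mem hD] with z ⟨hz0, hz⟩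
  by_cases he : e ∈ J
  · simp [monomialMul, cauchyOp, cauchyForm, he]
  have hint := integral_add_right_eq_self (μ := (volume : Measure ℂ))
    ((D e).indicator (cauchyIntegrand e (m e) ω J z)) (z e)
  rw [integral_indicator (hD e).measurableSet] at hint
  have hkey : ((∏ j, z j ^ (-m j)) * z e ^ m e) * ∫ ζ in D e, cauchyIntegrand e (m e) ω J z ζ =
      wedgeSign e J * ∫ t : ℂ, (Set.univ.pi D).indicator (monomialMul (-m) ω (insert e J))
        (z + Pi.single e t) * t⁻¹ := by
    rw [← hint, ← integral_const_mul, ← integral_const_mul]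
    simp only [monomial_mul_cauchyIntegrand ω hz (hz0 e)]
  have hpi : (Real.pi : ℂ) ≠ 0 := by exact_mod_cast Real.pi_ne_zero
  rw [monomialMul, cauchyOp, cauchyForm, if_neg he, if_neg he, cauchyTransform]
  simp only [Pi.neg_apply]
  -- The constant is -2i/(2πi) = -1/π.
  trans -((Real.pi : ℂ)⁻¹ * (((∏ j, z j ^ (-m j)) * z e ^ m e) *
    ∫ ζ in D e, cauchyIntegrand e (m e) ω J z ζ))
  · field_simp
  · rw [hkey]
    ring

theorem cauchyOpExists_of_integrableOn (hD : ∀ j, IsOpen (D j)) {R : ℝ}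
    (hR : ∀ z ∈ Set.univ.pi D, ∀ t : ℂ, z + Pi.single e t ∈ Set.univ.pi D → ‖t‖ < R)
    {ω : DbarForm n} (hω : ∀ J, IntegrableOn (monomialMul (-m) ω J) (Set.univ.pi D)) :
    CauchyOpExists (Set.univ.pi D) (D e) e (m e) ω := by
  intro J _
  have hPm : MeasurableSet (Set.univ.pi D) := MeasurableSet.univ_pi fun j => (hD j).measurableSet
  filter_upwards [ae_ne_zero_and_mem hD, ae_integrable_cauchyTransform (e := e)
    ((integrable_indicator_iff hPm).2 (hω (insert e J)))
    (fun z hz => indicator_of_notMem hz _) hPm hR] with z ⟨hz0, hz⟩ hint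
  have hc : (∏ j, z j ^ (-m j)) * z e ^ m e ≠ 0 :=
    mul_ne_zero (Finset.prod_ne_zero_iff.2 fun j _ => zpow_ne_zero _ (hz0 j))
      (zpow_ne_zero _ (hz0 e))
  have h1 := hint.const_mul (wedgeSign e J)
  simp only [← monomial_mul_cauchyIntegrand ω hz (hz0 e)] at h1
  have h2 := (h1.const_mul ((∏ j, z j ^ (-m j)) * z e ^ m e)⁻¹).comp_sub_right (z e)
  simp only [sub_add_cancel, inv_mul_cancel_left₀ hc] at h2
  exact (integrable_indicator_iff (hD e).measurableSet).1 h2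

end WeightedCauchyOp

/-! ### The weighted homotopy formula -/

theorem lemma4p1 {n : ℕ} (D : Fin n → Set ℂ)
    (hDopen : ∀ j, IsOpen (D j)) (hDconn : ∀ j, IsConnected (D j))
    (hDbdd : ∀ j, Bornology.IsBounded (D j))
    (P : Set (Fin n → ℂ)) (hP : P = Set.univ.pi D)
    -- The coordinates are numbered from 0: the variable `z_e` has number `e + 1` in `1, …, n`.
    (q : ℕ) (e : Fin n) (hq : 1 ≤ q) (hqe : q ≤ (e : ℕ) + 1)
    (p : ℝ≥0∞) (hp : 1 ≤ p) (s : Fin n → ℝ)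
    (m : Fin n → ℤ) (hm : ∀ j, m j ≤ dbarWeight p (s j))
    (ω : DbarForm n) (hω : MemWeightedLp P p s q ω)
    (K : Set ℂ) (hK : IsCompact K) (hKD : K ⊆ D e)
    (hsupp : ∀ J, ∀ᵐ z ∂(volume.restrict P), z e ∉ K → ω J z = 0)
    -- `dω` is the form `∂̄_m ω`
    (dω : DbarForm n) (hdω : IsDbarWeighted P m ω dω) (hdωLp : MemWeightedLp P p s (q + 1) dω) :
    CauchyOpExists P (D e) e (m e) ω ∧ CauchyOpExists P (D e) e (m e) dω ∧
    ∃ η : DbarForm n, IsOfDegree q η ∧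
      IsDbarWeighted P m (cauchyOp (D e) e (m e) ω) η ∧
      ∀ J, ∀ᵐ z ∂(volume.restrict P), ω J z = η J z + cauchyOp (D e) e (m e) dω J z := by
  subst hP
  have hDmeas : ∀ j, MeasurableSet (D j) := fun j => (hDopen j).measurableSet
  have hPm : MeasurableSet (Set.univ.pi D) := MeasurableSet.univ_pi hDmeas
  have hu := fun J => hω.integrableOn_monomialMul hDmeas hDbdd hp hm J
  have hv := fun J => hdωLp.integrableOn_monomialMul hDmeas hDbdd hp hm J
  obtain ⟨M, hM⟩ := (hDbdd e).exists_norm_le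
  have hR : ∀ z ∈ Set.univ.pi D, ∀ t : ℂ, z + Pi.single e t ∈ Set.univ.pi D → ‖t‖ < 2 * M + 1 := by
    intro z hz t ht
    have h1 := hM _ (hz e trivial)
    have h2 := hM _ (ht e trivial)
    simp only [Pi.add_apply, Pi.single_eq_same] at h2
    have h3 : ‖t‖ ≤ ‖z e + t‖ + ‖z e‖ := by
      simpa using norm_sub_le (z e + t) (z e)
    linarith
  have hdiff : ∀ J, monomialMul (-m) (ω - cauchyOp (D e) e (m e) dω) J
      =ᵐ[volume.restrict (Set.univ.pi D)] (monomialMul (-m) ω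
        - cauchyForm (Set.univ.pi D) e (monomialMul (-m) dω)) J := fun J => by
    filter_upwards [monomialMul_cauchyOp_ae_eq hDopen dω (J := J) (e := e) (m := m)] with z hz
    simp only [Pi.sub_apply, ← hz]
    simp only [monomialMul, Pi.sub_apply, mul_sub]
  -- The form η is defined by the desired identity; the content is that it represents ∂̄_m of the
  -- transformed ω.
  refine ⟨cauchyOpExists_of_integrableOn hDopen hR hu, cauchyOpExists_of_integrableOn hDopen hR hv,
    ω - cauchyOp (D e) e (m e) dω, ?_, ⟨?_, ?_, ?_⟩, fun J => Filter.Eventually.of_forall fun z => ?_⟩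
  · intro J hJ
    ext z
    have hzero : cauchyOp (D e) e (m e) dω J z = 0 := by
      by_cases he : e ∈ J
      · simp [cauchyOp, he]
      -- For e ∉ J, |J| ≠ q means |J ∪ {e}| ≠ q + 1, so the degree of ∂̄_m ω applies.
      · have hd : dω (insert e J) = 0 := hdωLp.1 _ (by
          rw [Finset.card_insert_of_notMem he]
          omega)
        have hint : cauchyIntegrand e (m e) dω J z = fun _ => 0 := by
          ext ζ
          simp [cauchyIntegrand, hd]
        simp [cauchyOp, hint]
    simp [hω.1 J hJ, hzero]
  · exact fun J => IntegrableOn.locallyIntegrableOn ((integrableOn_cauchyForm hPm hu hR J).congr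
      (monomialMul_cauchyOp_ae_eq hDopen ω).symm)
  · exact fun J => IntegrableOn.locallyIntegrableOn
      (((hu J).sub (integrableOn_cauchyForm hPm hv hR J)).congr (hdiff J).symm)
  · refine (IsWeakDbar.cauchyForm hDopen hR hu hv hdω.2.2 hK hKD fun J => ?_).congr
      (fun J => (monomialMul_cauchyOp_ae_eq hDopen ω).symm) fun J => (hdiff J).symm
    filter_upwards [hsupp J] with z hz hzK
    simp [monomialMul, hz hzK]
  · simp
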